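/- All triangulated categories below have all small coproducts and small Hom sets, and $\Sigma$ denotes the shift. Let $\mathcal{C}$ be such a category. An object $X$ is compact if $\mathrm{Hom}(X,-)$ commutes with coproducts; a compact generator is a compact object $G$ such that $\mathrm{Hom}(\Sigma^n G,X)=0$ for all $n\in\mathbb{Z}$ implies $X=0$. For an object $G$ and a set $I\subseteq\mathbb{Z}$ let $\overline{\langle G\rangle}^{I}$ be the full subcategory of direct summands of objects of the smallest full subcategory that contains $\Sigma^{-i}G$ for $i\in I$ and is closed under coproducts and extensions. For a t-structure, $\mathcal{C}^{\le n}=\Sigma^{-n}\mathcal{C}^{\le 0}$ and $\mathcal{C}^{\ge n}=\Sigma^{-n}\mathcal{C}^{\ge 0}$. Two t-structures $(\mathcal{C}_1^{\le 0},\mathcal{C}_1^{\ge 0})$ and $(\mathcal{C}_2^{\le 0},\mathcal{C}_2^{\ge 0})$ are equivalent if $\mathcal{C}_1^{\le -A}\subseteq\mathcal{C}_2^{\le 0}\subseteq\mathcal{C}_1^{\le A}$ for some integer $A>0$. The category $\mathcal{C}$ is weakly approximable if there are a compact generator $G$, a t-structure $(\mathcal{C}^{\le 0},\mathcal{C}^{\ge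 0})$ and an integer $A>0$ such that $\Sigma^A G\in\mathcal{C}^{\le 0}$, $\mathrm{Hom}(\Sigma^{-A}G,\mathcal{C}^{\le 0})=0$, and every $X\in\mathcal{C}^{\le 0}$ sits in an exact triangle $E\to X\to D\to\Sigma E$ with $E\in\overline{\langle G\rangle}^{[-A,A]}$ and $D\in\mathcal{C}^{\le -1}$. If $\mathcal{C}$ has a compact generator $G$, the preferred equivalence class of t-structures on $\mathcal{C}$ is that of the t-structure with aisle $\overline{\langle G\rangle}^{(-\infty,0]}$; it does not depend on $G$. With respect to any t-structure in this class, let $\mathcal{C}^{+}=\bigcup_{m>0}\mathcal{C}^{\ge -m}$, $\mathcal{C}^{-}=\bigcup_{m>0}\mathcal{C}^{\le m}$ and $\mathcal{C}^{b}=\mathcal{C}^{+}\cap\mathcal{C}^{-}$; let $\mathcal{C}^-_c$ consist of the objects $X$ such that for every integer $m>0$ there is an exact triangle $E\to X\to E'\to\Sigma E$ with $E$ compact and $E'\in\mathcal{C}^{\le -m}$; and let $\mathcal{C}^b_c=\mathcal{C}^-_c\cap\mathcal{C}^b$. These subcategories do not depend on the choice of the t-structure in the class. Let triangulated categories $\mathcal{D}_F,\mathcal{D},\mathcal{D}_U$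 be related by a recollement: exact functors $i_*\colon\mathcal{D}_F\to\mathcal{D}$, $i^*,i^!\colon\mathcal{D}\to\mathcal{D}_F$, $j^*\colon\mathcal{D}\to\mathcal{D}_U$ and $j_!,j_*\colon\mathcal{D}_U\to\mathcal{D}$ with adjunctions $i^*\dashv i_*\dashv i^!$ and $j_!\dashv j^*\dashv j_*$, with $j^*i_*=0$, with $i_*,j_!,j_*$ fully faithful, and with exact triangles $j_!j^*X\to X\to i_*i^*X\to\Sigma j_!j^*X$ and $i_*i^!X\to X\to j_*j^*X\to\Sigma i_*i^!X$ for every $X\in\mathcal{D}$, whose first two maps are the (co)units and whose third maps are natural in $X$. **Proposition.** Suppose that $\mathcal{D}_U$ is weakly approximable, that $\mathcal{D}$ has a compact generator $G$ with $\mathrm{Hom}_{\mathcal{D}}(\Sigma^{-n}G,G)=0$ for $n\gg 0$, and that $j^*G\in(\mathcal{D}_U)^-_c$. Then $$\mathcal{D}^-_c=\{X\in\mathcal{D}\mid i^*X\in(\mathcal{D}_F)^-_c\text{ and }j^*X\in(\mathcal{D}_U)^-_c\},$$ $$\mathcal{D}^b_c=\{X\in\mathcal{D}\mid i^*X\in(\mathcal{D}_F)^-_c,\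 j^*X\in(\mathcal{D}_U)^b_c\text{ and }i^!X\in(\mathcal{D}_F)^+\}.$$ -/

import Mathlib

open CategoryTheory CategoryTheory.Limits CategoryTheory.Pretriangulated
  CategoryTheory.Triangulated

universe v u u₁ u₂

namespace TriGluing

section OneCategory

variable {C : Type u} [Category.{v} C] [Preadditive C] [HasZeroObject C] [HasShift C ℤ]
  [∀ n : ℤ, (shiftFunctor C n).Additive] [Pretriangulated C] [HasCoproducts.{v} C]

open Classical in
/-- The canonical map `⨁ᵢ Hom(X, Yᵢ) → Hom(X, ∐ᵢ Yᵢ)`. -/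
noncomputable def homCoprodMap (X : C) {J : Type v} (Y : J → C) :
    (DirectSum J fun j => (X ⟶ Y j)) →+ (X ⟶ ∐ Y) :=
  DirectSum.toAddMonoid fun j => Preadditive.rightComp X (Sigma.ι Y j)

/-- `X` is compact: `Hom(X, -)` commutes with all small coproducts. -/
def IsCompactObj (X : C) : Prop :=
  ∀ (J : Type v) (Y : J → C), Function.Bijective (homCoprodMap X Y)

/-- `G` is a compact generator: it is compact, and an object receiving no nonzero morphism
from any shift of `G` is zero. -/
def IsCompactGenerator (G : C) : Prop :=
  IsCompactObj G ∧ ∀ X : C, (∀ (n : ℤ) (f : G⟦n⟧ ⟶ X), f = 0) → IsZero X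

/-- The objects (isomorphic to) `Σ⁻ⁱ G` with `i ∈ s`; for `s` an interval this is `G[A,B]`,
`G(-∞,B]`, and so on. -/
def shiftsOf (G : C) (s : Set ℤ) : ObjectProperty C :=
  fun Y => ∃ i ∈ s, Nonempty (Y ≅ G⟦-i⟧)

/-- The smallest full subcategory containing `P` that is closed under all small coproducts and
under extensions. -/
inductive Coprod (P : ObjectProperty C) : ObjectProperty C
  | of (X : C) (hX : P X) : Coprod P X
  | coproduct {J : Type v} (Y : J → C) (hY : ∀ j, Coprod P (Y j)) (c : Cofan Y)
      (hc : IsColimit c) : Coprod P c.pt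
  | extension (T : Triangle C) (hT : T ∈ distTriang C) (h₁ : Coprod P T.obj₁)
      (h₃ : Coprod P T.obj₃) : Coprod P T.obj₂

/-- The direct summands of objects of `Coprod (G s)`, where `G s = {Σ⁻ⁱ G | i ∈ s}`; for `s` an
interval `[A, B]` this is the subcategory denoted by `⟨G⟩` with superscript `[A, B]` (and an
overline). -/
def bigGen (G : C) (s : Set ℤ) : ObjectProperty C :=
  (Coprod (shiftsOf G s)).retractClosure

variable (C) in
/-- Weak approximability: there are a compact generator `G`, a t-structure and an integer `A > 0`
such that `Σᴬ G` is in degrees `≤ 0`, there are no nonzero maps from `Σ⁻ᴬ G` to objects in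
degrees `≤ 0`, and every object `X` in degrees `≤ 0` sits in an exact triangle `E → X → D → ΣE`
with `E` in `bigGen G [-A, A]` and `D` in degrees `≤ -1`. -/
def WeaklyApproximable : Prop :=
  ∃ (G : C) (t : TStructure C) (A : ℤ), IsCompactGenerator G ∧ 0 < A ∧
    t.le 0 (G⟦A⟧) ∧
    (∀ X : C, t.le 0 X → ∀ f : G⟦-A⟧ ⟶ X, f = 0) ∧
    ∀ X : C, t.le 0 X → ∃ (E D : C) (f : E ⟶ X) (g : X ⟶ D) (h : D ⟶ E⟦(1 : ℤ)⟧),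
      Triangle.mk f g h ∈ distTriang C ∧ bigGen G (Set.Icc (-A) A) E ∧ t.le (-1) D

/-- The aisle (the objects in degrees `≤ 0`) of the t-structure generated by `G`. -/
def genAisle (G : C) : ObjectProperty C := bigGen G (Set.Iic 0)

/-- Equivalence of the t-structures with aisles `P` and `Q`: there is an integer `A > 0` with
`P^{≤ -A} ⊆ Q^{≤ 0} ⊆ P^{≤ A}`. Here `P^{≤ n}` is `P.shift n = {X | Σⁿ X ∈ P}`. -/
def AislesEquivalent (P Q : ObjectProperty C) : Prop :=
  ∃ A : ℤ, 0 < A ∧ P.shift (-A) ≤ Q ∧ Q ≤ P.shift A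

/-- The t-structure `t` is in the preferred equivalence class: it is equivalent to the t-structure
generated by a compact generator. -/
def IsPreferred (t : TStructure C) : Prop :=
  ∃ G : C, IsCompactGenerator G ∧ AislesEquivalent (genAisle G) (t.le 0)

/-- The objects `X` such that for every integer `m > 0` there is an exact triangle
`E → X → E' → ΣE` with `E` compact and `E'` in degrees `≤ -m` for `t`. -/
def minusC (t : TStructure C) : ObjectProperty C := fun X =>
  ∀ m : ℤ, 0 < m → ∃ (E E' : C) (f : E ⟶ X) (g : X ⟶ E') (h : E' ⟶ E⟦(1 : ℤ)⟧),
    Triangle.mk f g h ∈ distTriang C ∧ IsCompactObj E ∧ t.le (-m) E'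

/-- The objects of `minusC t` that are bounded for `t`. -/
def boundedC (t : TStructure C) : ObjectProperty C := minusC t ⊓ t.bounded

variable (C) in
/-- The intrinsic subcategory `C⁻_c`, formed with a preferred t-structure. As equivalent
t-structures give the same subcategory, the choice does not matter. -/
def intrinsicMinusC : ObjectProperty C := fun X =>
  ∃ t : TStructure C, IsPreferred t ∧ minusC t X

variable (C) in
/-- The intrinsic subcategory `Cᵇ_c`, formed with a preferred t-structure. -/
def intrinsicBoundedC : ObjectProperty C := fun X =>
  ∃ t : TStructure C, IsPreferred t ∧ boundedC t X

variable (C) in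
/-- The intrinsic subcategory `C⁺` of bounded below objects, formed with a preferred
t-structure. -/
def intrinsicPlus : ObjectProperty C := fun X =>
  ∃ t : TStructure C, IsPreferred t ∧ t.plus X

end OneCategory

/-- A recollement of triangulated categories `DF → D → DU`: exact functors
`i^* ⊣ i_* ⊣ i^!` between `D` and `DF` and `j_! ⊣ j^* ⊣ j_*` between `DU` and `D`, with
`j^* i_* = 0`, with `i_*`, `j_!`, `j_*` fully faithful, and with the two functorial exact triangles
`j_! j^* X → X → i_* i^* X → Σ j_! j^* X` and `i_* i^! X → X → j_* j^* X → Σ i_* i^! X` whose first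
two maps are (co)units of the adjunctions. -/
structure Recollement (DF : Type u₁) (D : Type u) (DU : Type u₂)
    [Category.{v} DF] [Preadditive DF] [HasZeroObject DF] [HasShift DF ℤ]
    [∀ n : ℤ, (shiftFunctor DF n).Additive] [Pretriangulated DF]
    [Category.{v} D] [Preadditive D] [HasZeroObject D] [HasShift D ℤ]
    [∀ n : ℤ, (shiftFunctor D n).Additive] [Pretriangulated D]
    [Category.{v} DU] [Preadditive DU] [HasZeroObject DU] [HasShift DU ℤ]
    [∀ n : ℤ, (shiftFunctor DU n).Additive] [Pretriangulated DU] where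
  /-- the functor `i^*` -/
  iUpperStar : D ⥤ DF
  /-- the functor `i_*` -/
  iLowerStar : DF ⥤ D
  /-- the functor `i^!` -/
  iUpperShriek : D ⥤ DF
  /-- the functor `j_!` -/
  jLowerShriek : DU ⥤ D
  /-- the functor `j^*` -/
  jUpperStar : D ⥤ DU
  /-- the functor `j_*` -/
  jLowerStar : DU ⥤ D
  [commShift_iUpperStar : iUpperStar.CommShift ℤ]
  [commShift_iLowerStar : iLowerStar.CommShift ℤ]
  [commShift_iUpperShriek : iUpperShriek.CommShift ℤ]
  [commShift_jLowerShriek : jLowerShriek.CommShift ℤ]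
  [commShift_jUpperStar : jUpperStar.CommShift ℤ]
  [commShift_jLowerStar : jLowerStar.CommShift ℤ]
  [isTriangulated_iUpperStar : iUpperStar.IsTriangulated]
  [isTriangulated_iLowerStar : iLowerStar.IsTriangulated]
  [isTriangulated_iUpperShriek : iUpperShriek.IsTriangulated]
  [isTriangulated_jLowerShriek : jLowerShriek.IsTriangulated]
  [isTriangulated_jUpperStar : jUpperStar.IsTriangulated]
  [isTriangulated_jLowerStar : jLowerStar.IsTriangulated]
  /-- `i^* ⊣ i_*` -/
  adjIStar : iUpperStar ⊣ iLowerStar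
  /-- `i_* ⊣ i^!` -/
  adjIShriek : iLowerStar ⊣ iUpperShriek
  /-- `j_! ⊣ j^*` -/
  adjJShriek : jLowerShriek ⊣ jUpperStar
  /-- `j^* ⊣ j_*` -/
  adjJStar : jUpperStar ⊣ jLowerStar
  isZero_jUpperStar_iLowerStar (X : DF) : IsZero (jUpperStar.obj (iLowerStar.obj X))
  /-- the connecting transformation `i_* i^* → Σ j_! j^*` -/
  d : iUpperStar ⋙ iLowerStar ⟶ (jUpperStar ⋙ jLowerShriek) ⋙ shiftFunctor D (1 : ℤ)
  /-- the connecting transformation `j_* j^* → Σ i_* i^!` -/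
  d' : jUpperStar ⋙ jLowerStar ⟶ (iUpperShriek ⋙ iLowerStar) ⋙ shiftFunctor D (1 : ℤ)
  triangle_shriek_star (X : D) :
    Triangle.mk (adjJShriek.counit.app X) (adjIStar.unit.app X) (d.app X) ∈ distTriang D
  triangle_star_shriek (X : D) :
    Triangle.mk (adjIShriek.counit.app X) (adjJStar.unit.app X) (d'.app X) ∈ distTriang D
  [full_iLowerStar : iLowerStar.Full]
  [faithful_iLowerStar : iLowerStar.Faithful]
  [full_jLowerShriek : jLowerShriek.Full]
  [faithful_jLowerShriek : jLowerShriek.Faithful]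
  [full_jLowerStar : jLowerStar.Full]
  [faithful_jLowerStar : jLowerStar.Faithful]

end TriGluing

/-! The proof works with the t-structures generated by `G` on `D`, by `i^*G` on `DF` and by a
generator of `DU`; all membership questions are transported to these.

The central condition is `CompactVanishing`: a compact object has no nonzero maps to objects in
sufficiently negative degrees. It makes `minusC` a thick subcategory (`minusC_isTriangulated`,
`minusC_isStableUnderRetracts`). Hence an exact, coproduct-preserving functor `F` that sends one
compact generator into `minusC` sends every compact object there (`compactObjects_le`). Such an `F`
is also right t-exact up to a shift, so it preserves approximations and therefore `minusC`
(`minusC_map`).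

This is applied to `j^*`, `j_!`, `i^*` and `i_*`. The hypothesis handles `j^*G`, while `j_!` and
`i^*` preserve compactness because their right adjoints preserve coproducts. For `i_*`, the triangle
`j_! j^* G → G → i_* i^* G` puts `i_* i^* G` in `minusC`. Vanishing on `D` comes from the condition
on `Hom(Σ⁻ⁿG, G)`, on `DU` from weak approximability, and on `DF` by adjunction from the boundedness
above of `i_* i^* G`.

The first equality then follows from the triangle `j_! j^* X → X → i_* i^* X`. For the second, the
right adjoint of a functor that is right t-exact up to a shift preserves bounded below objects. This
covers `j^*`, `i^!`, `i_*` and `j_*`, and the triangle `i_* i^! X → X → j_* j^* X` glues the lower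
bounds. -/

namespace TriGluing

set_option linter.unusedSectionVars false

/-! ### Exactness and fill-ins for distinguished triangles -/

section Triangles

variable {C : Type u} [Category.{v} C] [Preadditive C] [HasZeroObject C] [HasShift C ℤ]
  [∀ n : ℤ, (shiftFunctor C n).Additive] [Pretriangulated C]
  {X Y Z : C} {f : X ⟶ Y} {g : Y ⟶ Z} {h : Z ⟶ X⟦(1 : ℤ)⟧}

lemma distTriang_comp₁₂ (hT : Triangle.mk f g h ∈ distTriang C) : f ≫ g = 0 :=
  comp_distTriang_mor_zero₁₂ _ hT

lemma distTriang_comp₃₁ (hT : Triangle.mk f g h ∈ distTriang C) : h ≫ f⟦(1 : ℤ)⟧' = 0 :=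
  comp_distTriang_mor_zero₃₁ _ hT

lemma exists_desc₂ (hT : Triangle.mk f g h ∈ distTriang C) {W : C} (a : Y ⟶ W) (ha : f ≫ a = 0) :
    ∃ b : Z ⟶ W, a = g ≫ b :=
  Triangle.yoneda_exact₂ _ hT a ha

lemma exists_lift₂ (hT : Triangle.mk f g h ∈ distTriang C) {W : C} (a : W ⟶ Y) (ha : a ≫ g = 0) :
    ∃ b : W ⟶ X, a = b ≫ f :=
  Triangle.coyoneda_exact₂ _ hT a ha

lemma exists_lift₃ (hT : Triangle.mk f g h ∈ distTriang C) {W : C} (a : W ⟶ Z) (ha : a ≫ h = 0) :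
    ∃ b : W ⟶ Y, a = b ≫ g :=
  Triangle.coyoneda_exact₃ _ hT a ha

lemma exists_hom₁ {X' Y' Z' : C} {f' : X' ⟶ Y'} {g' : Y' ⟶ Z'} {h' : Z' ⟶ X'⟦(1 : ℤ)⟧}
    (hT : Triangle.mk f g h ∈ distTriang C) (hT' : Triangle.mk f' g' h' ∈ distTriang C)
    (b : Y ⟶ Y') (c : Z ⟶ Z') (hbc : g ≫ c = b ≫ g') :
    ∃ a : X ⟶ X', f ≫ b = a ≫ f' ∧ h ≫ a⟦(1 : ℤ)⟧' = c ≫ h' :=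
  complete_distinguished_triangle_morphism₁ _ _ hT hT' b c hbc

lemma exists_hom₂ {X' Y' Z' : C} {f' : X' ⟶ Y'} {g' : Y' ⟶ Z'} {h' : Z' ⟶ X'⟦(1 : ℤ)⟧}
    (hT : Triangle.mk f g h ∈ distTriang C) (hT' : Triangle.mk f' g' h' ∈ distTriang C)
    (a : X ⟶ X') (c : Z ⟶ Z') (hac : h ≫ a⟦(1 : ℤ)⟧' = c ≫ h') :
    ∃ b : Y ⟶ Y', f ≫ b = a ≫ f' ∧ g ≫ c = b ≫ g' :=
  complete_distinguished_triangle_morphism₂ _ _ hT hT' a c hac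

end Triangles

/-! ### Compact objects form a thick subcategory -/

section Compact

variable {C : Type u} [Category.{v} C] [Preadditive C] [HasZeroObject C] [HasShift C ℤ]
  [∀ n : ℤ, (shiftFunctor C n).Additive] [Pretriangulated C] [HasCoproducts.{v} C]

open Classical in
lemma homCoprodMap_eq_sum (X : C) {J : Type v} (Y : J → C) (x : DirectSum J fun j => (X ⟶ Y j)) :
    homCoprodMap X Y x = ∑ j ∈ DFinsupp.support x, x j ≫ Sigma.ι Y j := by
  simp only [homCoprodMap, DirectSum.toAddMonoid, DFinsupp.liftAddHom_apply]
  rw [DFinsupp.sumAddHom_apply, DFinsupp.sum]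
  rfl

/-- Every morphism from a compact object to a coproduct is a finite sum of morphisms through
the inclusions. -/
lemma IsCompactObj.exists_sum {X : C} (hX : IsCompactObj X) {J : Type v} {Y : J → C}
    (c : Cofan Y) (hc : IsColimit c) (f : X ⟶ c.pt) :
    ∃ (s : Finset J) (a : ∀ j, X ⟶ Y j), f = ∑ j ∈ s, a j ≫ c.inj j := by
  classical
  obtain ⟨x, hx⟩ := (hX J Y).2
    (f ≫ (hc.coconePointUniqueUpToIso (coproductIsCoproduct Y)).hom)
  refine ⟨DFinsupp.support x, fun j => x j, ?_⟩
  rw [homCoprodMap_eq_sum] at hx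
  rw [← cancel_mono (hc.coconePointUniqueUpToIso (coproductIsCoproduct Y)).hom, ← hx,
    Preadditive.sum_comp]
  refine Finset.sum_congr rfl fun j _ => ?_
  have := hc.comp_coconePointUniqueUpToIso_hom (coproductIsCoproduct Y) ⟨j⟩
  simp only [Category.assoc]
  congr 1
  exact this.symm

open Classical in
lemma isCompactObj_of_exists_sum {X : C}
    (hX : ∀ (J : Type v) (Y : J → C) (f : X ⟶ ∐ Y),
      ∃ (s : Finset J) (a : ∀ j, X ⟶ Y j), f = ∑ j ∈ s, a j ≫ Sigma.ι Y j) :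
    IsCompactObj X := by
  intro J Y
  refine ⟨(injective_iff_map_eq_zero _).2 fun x hx => ?_, fun f => ?_⟩
  · rw [homCoprodMap_eq_sum] at hx
    ext j
    by_cases hj : j ∈ DFinsupp.support x
    · have := hx =≫ Sigma.π Y j
      rw [Preadditive.sum_comp, zero_comp, Finset.sum_eq_single j] at this
      · simpa using this
      · intro k _ hk
        simp [Sigma.ι_π_of_ne _ hk]
      · exact fun h => (h hj).elim
    · simpa using hj
  · obtain ⟨s, a, rfl⟩ := hX J Y f
    refine ⟨∑ j ∈ s, DirectSum.of (fun j => (X ⟶ Y j)) j (a j), ?_⟩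
    rw [map_sum]
    exact Finset.sum_congr rfl fun j _ => by
      simp only [homCoprodMap, DirectSum.toAddMonoid_of]
      rfl

/-- A morphism from a compact object to a coproduct has finite support. -/
lemma IsCompactObj.exists_finset_comp_pi {X : C} (hX : IsCompactObj X) {J : Type v} [DecidableEq J]
    {Y : J → C}
    (f : X ⟶ ∐ Y) : ∃ s : Finset J, ∀ j ∉ s, f ≫ Sigma.π Y j = 0 := by
  obtain ⟨s, a, rfl⟩ := hX.exists_sum _ (coproductIsCoproduct Y) f
  refine ⟨s, fun j hj => ?_⟩
  rw [Preadditive.sum_comp]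
  refine Finset.sum_eq_zero fun k hk => ?_
  have : k ≠ j := fun h => hj (h ▸ hk)
  change (a k ≫ Sigma.ι Y k) ≫ _ = 0
  simp [Sigma.ι_π_of_ne _ this]

lemma IsCompactObj.eq_zero_of_comp_pi {X : C} (hX : IsCompactObj X) {J : Type v} [DecidableEq J]
    {Y : J → C}
    (f : X ⟶ ∐ Y) (hf : ∀ j, f ≫ Sigma.π Y j = 0) : f = 0 := by
  obtain ⟨s, a, rfl⟩ := hX.exists_sum _ (coproductIsCoproduct Y) f
  refine Finset.sum_eq_zero fun j hj => ?_
  have := hf j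
  rw [Preadditive.sum_comp, Finset.sum_eq_single j] at this
  · change (a j ≫ Sigma.ι Y j) ≫ _ = 0 at this
    rw [Category.assoc, Sigma.ι_π_eq_id, Category.comp_id] at this
    rw [this, zero_comp]
  · intro k _ hk
    change (a k ≫ Sigma.ι Y k) ≫ _ = 0
    simp [Sigma.ι_π_of_ne _ hk]
  · exact fun h => (h hj).elim

open Classical in
/-- The endomorphism of a coproduct projecting onto the summands with index in `s`. -/
noncomputable def finsetProj {J : Type v} (Y : J → C) (s : Finset J) : ∐ Y ⟶ ∐ Y :=
  ∑ j ∈ s, Sigma.π Y j ≫ Sigma.ι Y j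

open Classical in
lemma ι_finsetProj_of_mem {J : Type v} (Y : J → C) {s : Finset J} {j : J} (hj : j ∈ s) :
    Sigma.ι Y j ≫ finsetProj Y s = Sigma.ι Y j := by
  rw [finsetProj, Preadditive.comp_sum, Finset.sum_eq_single j]
  · simp
  · intro k _ hk
    rw [Sigma.ι_π_of_ne_assoc _ hk.symm, zero_comp]
  · exact fun h => (h hj).elim

/-- Expressing compactness as the vanishing of a composite lets it be propagated along the exact
sequences of a triangle. -/
lemma IsCompactObj.exists_finsetProj {X : C} (hX : IsCompactObj X) {J : Type v} {Y : J → C}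
    (f : X ⟶ ∐ Y) : ∃ s : Finset J, f ≫ (𝟙 _ - finsetProj Y s) = 0 := by
  obtain ⟨s, a, rfl⟩ := hX.exists_sum _ (coproductIsCoproduct Y) f
  refine ⟨s, ?_⟩
  rw [Preadditive.sum_comp]
  refine Finset.sum_eq_zero fun j hj => ?_
  change (a j ≫ Sigma.ι Y j) ≫ _ = 0
  rw [Category.assoc, Preadditive.comp_sub, ι_finsetProj_of_mem Y hj, Category.comp_id, sub_self,
    comp_zero]

lemma finsetProj_comp_of_subset {J : Type v} (Y : J → C) {s t : Finset J} (h : s ⊆ t) :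
    finsetProj Y s ≫ (𝟙 _ - finsetProj Y t) = 0 := by
  nth_rw 1 [finsetProj]
  rw [Preadditive.sum_comp]
  refine Finset.sum_eq_zero fun j hj => ?_
  rw [Category.assoc, Preadditive.comp_sub, ι_finsetProj_of_mem Y (h hj), Category.comp_id,
    sub_self, comp_zero]

lemma comp_one_sub_finsetProj_of_subset {X : C} {J : Type v} {Y : J → C} {s t : Finset J}
    (h : s ⊆ t) (f : X ⟶ ∐ Y) (hf : f ≫ (𝟙 _ - finsetProj Y s) = 0) :
    f ≫ (𝟙 _ - finsetProj Y t) = 0 := by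
  have : f = f ≫ finsetProj Y s := by
    rwa [Preadditive.comp_sub, Category.comp_id, sub_eq_zero] at hf
  rw [this, Category.assoc, finsetProj_comp_of_subset Y h, comp_zero]

open Classical in
lemma isCompactObj_of_exists_finsetProj {X : C}
    (hX : ∀ (J : Type v) (Y : J → C) (f : X ⟶ ∐ Y),
      ∃ s : Finset J, f ≫ (𝟙 _ - finsetProj Y s) = 0) : IsCompactObj X := by
  refine isCompactObj_of_exists_sum fun J Y f => ?_
  obtain ⟨s, hs⟩ := hX J Y f
  refine ⟨s, fun j => f ≫ Sigma.π Y j, ?_⟩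
  rw [Preadditive.comp_sub, Category.comp_id, sub_eq_zero] at hs
  nth_rw 1 [hs]
  simp [finsetProj, Preadditive.comp_sum]

variable (C) in
/-- The full subcategory of compact objects. -/
abbrev compactObjects : ObjectProperty C := fun X => IsCompactObj X

instance : (compactObjects C).IsStableUnderRetracts where
  of_retract {X Y} r hY := isCompactObj_of_exists_finsetProj fun J Z f => by
    obtain ⟨s, hs⟩ := IsCompactObj.exists_finsetProj hY (r.r ≫ f)
    refine ⟨s, ?_⟩
    rw [← Category.id_comp f, ← r.retract, Category.assoc, Category.assoc, ← Category.assoc r.r, hs,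
      comp_zero]

/-- A functor whose right adjoint preserves coproducts preserves compact objects. -/
lemma IsCompactObj.map_leftAdjoint {C' : Type u₁} [Category.{v} C'] [Preadditive C']
    [HasZeroObject C'] [HasShift C' ℤ] [∀ n : ℤ, (shiftFunctor C' n).Additive] [Pretriangulated C']
    [HasCoproducts.{v} C'] {F : C ⥤ C'} {R : C' ⥤ C} (adj : F ⊣ R) [F.Additive]
    [∀ J : Type v, PreservesColimitsOfShape (Discrete J) R] {X : C} (hX : IsCompactObj X) :
    IsCompactObj (F.obj X) := by
  refine isCompactObj_of_exists_sum fun J Y f => ?_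
  obtain ⟨s, a, ha⟩ := hX.exists_sum _ (isColimitCofanMkObjOfIsColimit R _ _
    (coproductIsCoproduct Y)) (adj.homEquiv _ _ f)
  refine ⟨s, fun j => (adj.homEquiv _ _).symm (a j), ?_⟩
  rw [← (adj.homEquiv _ _).symm_apply_apply f, ha, adj.homEquiv_counit, F.map_sum,
    Preadditive.sum_comp]
  refine Finset.sum_congr rfl fun j _ => ?_
  simp only [adj.homEquiv_counit, Functor.map_comp, Category.assoc]
  congr 1
  exact adj.counit_naturality _

instance : (compactObjects C).IsTriangulated where
  exists_zero := ⟨_, isZero_zero C, isCompactObj_of_exists_finsetProj fun J Y f =>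
    ⟨∅, (isZero_zero C).eq_of_src _ _⟩⟩
  isStableUnderShiftBy n := ⟨fun X hX =>
    IsCompactObj.map_leftAdjoint (F := shiftFunctor C n) (R := shiftFunctor C (-n))
      (shiftEquiv C n).toAdjunction hX⟩
  toIsTriangulatedClosed₂ := .mk' fun T hT h₁ h₃ =>
    isCompactObj_of_exists_finsetProj fun J Y f => by
      classical
      obtain ⟨s, hs⟩ := IsCompactObj.exists_finsetProj h₁ (T.mor₁ ≫ f)
      -- Removing the summands in `s` kills the restriction to the first vertex, so what is left
      -- factors through the third, where compactness yields `s'`.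
      obtain ⟨g, hg⟩ := Triangle.yoneda_exact₂ _ hT (f ≫ (𝟙 _ - finsetProj Y s))
        (by rw [← Category.assoc, hs])
      obtain ⟨s', hs'⟩ := IsCompactObj.exists_finsetProj h₃ g
      refine ⟨s ∪ s', ?_⟩
      have h := comp_one_sub_finsetProj_of_subset Finset.subset_union_right g hs'
        (t := s ∪ s')
      have h' : (f ≫ (𝟙 _ - finsetProj Y s)) ≫ (𝟙 _ - finsetProj Y (s ∪ s')) = 0 := by
        rw [hg, Category.assoc, h, comp_zero]
      rwa [Category.assoc, Preadditive.sub_comp (g := 𝟙 _ - finsetProj Y (s ∪ s')),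
        finsetProj_comp_of_subset Y Finset.subset_union_left, sub_zero, Category.id_comp] at h'

end Compact

/-! ### Homotopy colimits of sequences and maps from compact objects -/

section Telescope

variable {C : Type u} [Category.{v} C] [Preadditive C] [HasZeroObject C] [HasShift C ℤ]
  [∀ n : ℤ, (shiftFunctor C n).Additive] [Pretriangulated C] [HasCoproducts.{v} C]

/-- The endomorphism of `∐ Xₙ` induced by the transition maps of a sequence. -/
noncomputable def transition {X : ℕ → C} (φ : ∀ n, X n ⟶ X (n + 1)) :
    (∐ fun k : ULift.{v} ℕ => X k.down) ⟶ ∐ fun k : ULift.{v} ℕ => X k.down :=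
  Sigma.desc fun k => φ k.down ≫ Sigma.ι (fun k : ULift.{v} ℕ => X k.down) ⟨k.down + 1⟩

lemma transition_pi_zero {X : ℕ → C} (φ : ∀ n, X n ⟶ X (n + 1)) :
    transition φ ≫ Sigma.π (fun k : ULift.{v} ℕ => X k.down) ⟨0⟩ = 0 := by
  refine Sigma.hom_ext _ _ fun k => ?_
  have h : (⟨k.down + 1⟩ : ULift.{v} ℕ) ≠ ⟨0⟩ := fun h => by simpa using congrArg ULift.down h
  rw [transition, Sigma.ι_desc_assoc, Category.assoc, Sigma.ι_π_of_ne _ h, comp_zero, comp_zero]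

lemma transition_pi_succ {X : ℕ → C} (φ : ∀ n, X n ⟶ X (n + 1)) (n : ℕ) :
    transition φ ≫ Sigma.π (fun k : ULift.{v} ℕ => X k.down) ⟨n + 1⟩ =
      Sigma.π (fun k : ULift.{v} ℕ => X k.down) ⟨n⟩ ≫ φ n := by
  refine Sigma.hom_ext _ _ fun k => ?_
  rw [transition, Sigma.ι_desc_assoc, Category.assoc]
  obtain ⟨k⟩ := k
  by_cases hk : k = n
  · subst hk
    rw [Sigma.ι_π_eq_id, Sigma.ι_π_eq_id_assoc, Category.comp_id]
  · have h : (⟨k + 1⟩ : ULift.{v} ℕ) ≠ ⟨n + 1⟩ := fun h => hk (by simpa using congrArg ULift.down h)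
    have h' : (⟨k⟩ : ULift.{v} ℕ) ≠ ⟨n⟩ := fun h => hk (by simpa using congrArg ULift.down h)
    rw [Sigma.ι_π_of_ne _ h, Sigma.ι_π_of_ne_assoc _ h', comp_zero, zero_comp]

/-- `H`, with the maps `c n : X n ⟶ H`, is a homotopy colimit of the sequence `X`. -/
def IsTelescope {X : ℕ → C} (φ : ∀ n, X n ⟶ X (n + 1)) (H : C) (c : ∀ n, X n ⟶ H) : Prop :=
  ∃ (p : (∐ fun k : ULift.{v} ℕ => X k.down) ⟶ H) (d : H ⟶ _),
    Triangle.mk (𝟙 _ - transition φ) p d ∈ distTriang C ∧ ∀ n, c n = Sigma.ι _ ⟨n⟩ ≫ p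

lemma exists_isTelescope {X : ℕ → C} (φ : ∀ n, X n ⟶ X (n + 1)) :
    ∃ (H : C) (c : ∀ n, X n ⟶ H), IsTelescope φ H c := by
  obtain ⟨H, p, d, h⟩ := distinguished_cocone_triangle (𝟙 _ - transition φ)
  exact ⟨H, _, p, d, h, fun n => rfl⟩

/-- The map `1 - transition φ` is injective on morphisms out of a compact object. -/
lemma IsCompactObj.eq_zero_of_comp_one_sub_transition {X : ℕ → C} (φ : ∀ n, X n ⟶ X (n + 1))
    {K : C} (hK : IsCompactObj K) (b : K ⟶ ∐ fun k : ULift.{v} ℕ => X k.down)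
    (hb : b ≫ (𝟙 _ - transition φ) = 0) : b = 0 := by
  have hb' : b = b ≫ transition φ := by
    rwa [Preadditive.comp_sub, Category.comp_id, sub_eq_zero] at hb
  -- A fixed point of the transition map has zero component at 0, and each later component is the
  -- image of the previous one.
  refine hK.eq_zero_of_comp_pi b ?_
  rintro ⟨n⟩
  induction n with
  | zero => rw [hb', Category.assoc, transition_pi_zero, comp_zero]
  | succ n ih => rw [hb', Category.assoc, transition_pi_succ, reassoc_of% ih, zero_comp]

namespace IsTelescope

variable {X : ℕ → C} {φ : ∀ n, X n ⟶ X (n + 1)} {H : C} {c : ∀ n, X n ⟶ H}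

lemma w (h : IsTelescope φ H c) (n : ℕ) : φ n ≫ c (n + 1) = c n := by
  obtain ⟨p, d, hT, hc⟩ := h
  have := Sigma.ι (fun k : ULift.{v} ℕ => X k.down) ⟨n⟩ ≫= distTriang_comp₁₂ hT
  rw [Preadditive.sub_comp, Preadditive.comp_sub, transition, Sigma.ι_desc_assoc, comp_zero,
    sub_eq_zero] at this
  rw [hc, hc, ← Category.assoc, ← this, Category.id_comp]

lemma exists_desc (h : IsTelescope φ H c) {Z : C} (f : ∀ n, X n ⟶ Z)
    (hf : ∀ n, φ n ≫ f (n + 1) = f n) : ∃ g : H ⟶ Z, ∀ n, c n ≫ g = f n := by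
  obtain ⟨p, d, hT, hc⟩ := h
  obtain ⟨g, hg⟩ := exists_desc₂ hT (Sigma.desc fun k => f k.down) (by
    refine Sigma.hom_ext _ _ fun k => ?_
    rw [Preadditive.sub_comp, Preadditive.comp_sub, transition, Sigma.ι_desc_assoc, Category.assoc,
      Sigma.ι_desc, Category.id_comp, Sigma.ι_desc, hf, sub_self, comp_zero])
  refine ⟨g, fun n => ?_⟩
  rw [hc, Category.assoc, ← hg, Sigma.ι_desc]

lemma c_eq (h : IsTelescope φ H c) (n d : ℕ) : ∃ a : X n ⟶ X (n + d), a ≫ c (n + d) = c n := by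
  induction d with
  | zero => exact ⟨𝟙 _, Category.id_comp _⟩
  | succ d ih =>
    obtain ⟨a, ha⟩ := ih
    exact ⟨a ≫ φ _, by rw [Category.assoc]; exact (congrArg (a ≫ ·) (h.w (n + d))).trans ha⟩

/-- After desuspension, the composite becomes a map from a compact object killed by `1 - transition
φ`, hence zero. -/
lemma comp_d_eq_zero {p : (∐ fun k : ULift.{v} ℕ => X k.down) ⟶ H} {d : H ⟶ _}
    (hT : Triangle.mk (𝟙 _ - transition φ) p d ∈ distTriang C) {K : C} (hK : IsCompactObj K)
    (g : K ⟶ H) : g ≫ d = 0 := by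
  have h0 : (g ≫ d) ≫ (𝟙 _ - transition φ)⟦(1 : ℤ)⟧' = 0 := by
    rw [Category.assoc, distTriang_comp₃₁ hT, comp_zero]
  let e : K⟦(-1 : ℤ)⟧⟦(1 : ℤ)⟧ ≅ K := shiftNegShift K 1
  obtain ⟨b, hb⟩ := (shiftFunctor C (1 : ℤ)).map_surjective (e.hom ≫ g ≫ d)
  have hb0 : b = 0 := by
    refine IsCompactObj.eq_zero_of_comp_one_sub_transition φ
      ((compactObjects C).le_shift (-1 : ℤ) K hK) b ?_
    apply (shiftFunctor C (1 : ℤ)).map_injective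
    rw [Functor.map_comp, hb, Functor.map_zero, Category.assoc, h0, comp_zero]
  rw [hb0, Functor.map_zero] at hb
  rw [← cancel_epi e.hom, ← hb, comp_zero]

lemma exists_factor (h : IsTelescope φ H c) {K : C} (hK : IsCompactObj K) (g : K ⟶ H) :
    ∃ (n : ℕ) (a : K ⟶ X n), a ≫ c n = g := by
  obtain ⟨p, d, hT, hc⟩ := id h
  obtain ⟨b, hb⟩ := exists_lift₃ hT g (comp_d_eq_zero hT hK g)
  obtain ⟨s, a, rfl⟩ := hK.exists_sum _ (coproductIsCoproduct _) b
  obtain ⟨N, hN⟩ : ∃ N : ℕ, ∀ k ∈ s, k.down ≤ N :=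
    ⟨s.sup ULift.down, fun k hk => Finset.le_sup (f := ULift.down) hk⟩
  have key : ∀ k ∈ s, ∃ a' : K ⟶ X N, a' ≫ c N = a k ≫ c k.down := by
    intro k hk
    obtain ⟨d, rfl⟩ := Nat.exists_eq_add_of_le (hN k hk)
    obtain ⟨t, ht⟩ := h.c_eq k.down d
    exact ⟨a k ≫ t, by rw [Category.assoc, ht]⟩
  choose! a' ha' using key
  refine ⟨N, ∑ k ∈ s, a' k, ?_⟩
  rw [hb, Preadditive.sum_comp, Preadditive.sum_comp]
  refine Finset.sum_congr rfl fun k hk => ?_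
  rw [ha' k hk, hc, Category.assoc]
  rfl

/-- If a compatible family of morphisms from a compact object vanishes in the homotopy colimit,
then it vanishes at some stage. -/
lemma exists_eq_zero (h : IsTelescope φ H c) {K : C} (hK : IsCompactObj K) (a : ∀ n, K ⟶ X n)
    (ha : ∀ n, a n ≫ φ n = a (n + 1)) (h0 : a 0 ≫ c 0 = 0) : ∃ m, a m = 0 := by
  classical
  obtain ⟨p, d, hT, hc⟩ := h
  obtain ⟨y, hy⟩ := exists_lift₂ hT (a 0 ≫ Sigma.ι (fun k : ULift.{v} ℕ => X k.down) ⟨0⟩)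
    (by rw [Category.assoc, ← hc, h0])
  have hy' : y = a 0 ≫ Sigma.ι (fun k : ULift.{v} ℕ => X k.down) ⟨0⟩ + y ≫ transition φ := by
    rw [hy, Preadditive.comp_sub, Category.comp_id, sub_add_cancel]
  -- Solving `y = a 0 + y ≫ transition φ` componentwise recovers the whole family `a`; the finite
  -- support of `y` then forces some `a m` to vanish.
  have key : ∀ n, y ≫ Sigma.π (fun k : ULift.{v} ℕ => X k.down) ⟨n⟩ = a n := by
    intro n
    induction n with
    | zero =>
      rw [hy', Preadditive.add_comp, Category.assoc, Category.assoc, transition_pi_zero,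
        comp_zero, add_zero, Sigma.ι_π_eq_id, Category.comp_id]
    | succ n ih =>
      have hne : (⟨0⟩ : ULift.{v} ℕ) ≠ ⟨n + 1⟩ := fun h => by simpa using congrArg ULift.down h
      rw [hy', Preadditive.add_comp, Category.assoc, Category.assoc, transition_pi_succ,
        Sigma.ι_π_of_ne _ hne, comp_zero, zero_add, reassoc_of% ih, ha]
  obtain ⟨s, hs⟩ := hK.exists_finset_comp_pi y
  obtain ⟨m, hm⟩ := Infinite.exists_notMem_finset s
  exact ⟨m.down, by rw [← key]; exact hs m hm⟩

end IsTelescope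

end Telescope

/-! ### Closure under coproducts, extensions and summands -/

section Closure

variable {C : Type u} [Category.{v} C] [Preadditive C] [HasZeroObject C] [HasShift C ℤ]
  [∀ n : ℤ, (shiftFunctor C n).Additive] [Pretriangulated C] [HasCoproducts.{v} C]

/-- `Q` is closed under small coproducts and extensions. -/
structure IsCoprodExtClosed (Q : ObjectProperty C) : Prop where
  coproduct {J : Type v} (Y : J → C) (hY : ∀ j, Q (Y j)) (c : Cofan Y) (hc : IsColimit c) : Q c.pt
  extension (T : Triangle C) (hT : T ∈ distTriang C) (h₁ : Q T.obj₁) (h₃ : Q T.obj₃) : Q T.obj₂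

namespace IsCoprodExtClosed

variable {Q : ObjectProperty C}

lemma coprod_le (hQ : IsCoprodExtClosed Q) {P : ObjectProperty C} (h : P ≤ Q) : Coprod P ≤ Q := by
  intro X hX
  induction hX with
  | of X hX => exact h X hX
  | coproduct Y _ c hc ih => exact hQ.coproduct Y ih c hc
  | extension T hT _ _ h₁ h₃ => exact hQ.extension T hT h₁ h₃

lemma bigGen_le (hQ : IsCoprodExtClosed Q) [Q.IsStableUnderRetracts] {G : C} {s : Set ℤ}
    (h : ∀ i ∈ s, Q (G⟦-i⟧)) : bigGen G s ≤ Q := by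
  refine (ObjectProperty.monotone_retractClosure (hQ.coprod_le ?_)).trans
    Q.retractClosure_eq_self.le
  rintro X ⟨i, hi, ⟨e⟩⟩
  exact Q.prop_of_iso e.symm (h i hi)

/-- `bigGen` takes summands only once, at the end, so its closure under coproducts and extensions
needs this. -/
lemma retractClosure (hQ : IsCoprodExtClosed Q) : IsCoprodExtClosed Q.retractClosure where
  coproduct {J} Y hY c hc := by
    choose Z hZ r using hY
    have r' := fun j => (r j).some
    refine ⟨∐ Z, hQ.coproduct Z hZ _ (coproductIsCoproduct Z), ⟨⟨?_, ?_, ?_⟩⟩⟩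
    · exact Cofan.IsColimit.desc hc fun j => (r' j).i ≫ Sigma.ι Z j
    · exact Sigma.desc fun j => (r' j).r ≫ c.inj j
    · refine Cofan.IsColimit.hom_ext hc _ _ fun j => ?_
      simp
  extension T hT h₁ h₃ := by
    have := Q.extensionProduct_retractClosure_retractClosure_le Q T.obj₂
      ⟨_, _, _, _, _, hT, h₁, h₃⟩
    refine ObjectProperty.monotone_retractClosure ?_ _ this
    rintro X ⟨_, _, _, _, _, hT, h₁, h₃⟩
    exact hQ.extension _ hT h₁ h₃

lemma leftOrthogonal (P : ObjectProperty C) : IsCoprodExtClosed P.leftOrthogonal where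
  coproduct {J} Y hY c hc Z f hZ := Cofan.IsColimit.hom_ext hc _ _ fun j => by
    rw [comp_zero]
    exact hY j _ hZ
  extension T hT h₁ h₃ := P.leftOrthogonal.ext_of_isTriangulatedClosed₂ T hT h₁ h₃

instance (P : ObjectProperty C) : P.leftOrthogonal.IsStableUnderRetracts where
  of_retract r hY Z f hZ := by
    rw [← Category.id_comp f, ← r.retract, Category.assoc, hY (r.r ≫ f) hZ, comp_zero]

lemma shift (hQ : IsCoprodExtClosed Q) (a : ℤ) : IsCoprodExtClosed (Q.shift a) where
  coproduct _ hY c hc :=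
    hQ.coproduct _ hY (Cofan.mk _ fun j => (shiftFunctor C a).map (c.inj j))
      (isColimitCofanMkObjOfIsColimit (shiftFunctor C a) _ c.inj hc)
  extension T hT h₁ h₃ := hQ.extension _ (Triangle.shift_distinguished T hT a) h₁ h₃

lemma inverseImage {C' : Type u₁} [Category.{v} C'] [Preadditive C']
    [HasZeroObject C'] [HasShift C' ℤ] [∀ n : ℤ, (shiftFunctor C' n).Additive] [Pretriangulated C']
    [HasCoproducts.{v} C'] (F : C' ⥤ C) [F.CommShift ℤ] [F.IsTriangulated]
    [∀ J : Type v, PreservesColimitsOfShape (Discrete J) F] (hQ : IsCoprodExtClosed Q) :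
    IsCoprodExtClosed (Q.inverseImage F) where
  coproduct _ hY c hc :=
    hQ.coproduct _ hY (Cofan.mk _ fun j => F.map (c.inj j))
      (isColimitCofanMkObjOfIsColimit F _ c.inj hc)
  extension T hT h₁ h₃ := hQ.extension _ (F.map_distinguished T hT) h₁ h₃

end IsCoprodExtClosed

lemma coprod_isCoprodExtClosed (P : ObjectProperty C) : IsCoprodExtClosed (Coprod P) where
  coproduct Y hY c hc := .coproduct Y hY c hc
  extension T hT h₁ h₃ := .extension T hT h₁ h₃

lemma bigGen_isCoprodExtClosed (G : C) (s : Set ℤ) : IsCoprodExtClosed (bigGen G s) :=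
  (coprod_isCoprodExtClosed _).retractClosure

instance (P : ObjectProperty C) : P.retractClosure.IsStableUnderRetracts where
  of_retract := by
    rintro X Y r ⟨Z, hZ, ⟨r'⟩⟩
    exact ⟨Z, hZ, ⟨r.trans r'⟩⟩

instance (G : C) (s : Set ℤ) : (bigGen G s).IsStableUnderRetracts := by
  unfold bigGen
  infer_instance

instance {C' : Type*} [Category C'] (F : C' ⥤ C) (Q : ObjectProperty C)
    [Q.IsStableUnderRetracts] : (Q.inverseImage F).IsStableUnderRetracts where
  of_retract r h := Q.prop_of_retract (r.map F) h

instance (Q : ObjectProperty C) (a : ℤ) [Q.IsStableUnderRetracts] :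
    (Q.shift a).IsStableUnderRetracts where
  of_retract r h := Q.prop_of_retract (r.map (shiftFunctor C a)) h

lemma bigGen_shift_mem (G : C) {s : Set ℤ} {i : ℤ} (hi : i ∈ s) : bigGen G s (G⟦-i⟧) :=
  ObjectProperty.le_retractClosure _ _ (.of _ ⟨i, hi, ⟨Iso.refl _⟩⟩)

end Closure

/-! ### The t-structure generated by a compact object -/

section GeneratedTStructure

variable {C : Type u} [Category.{v} C] [Preadditive C] [HasZeroObject C] [HasShift C ℤ]
  [∀ n : ℤ, (shiftFunctor C n).Additive] [Pretriangulated C] [HasCoproducts.{v} C]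

lemma bigGen_mono (G : C) {s s' : Set ℤ} (h : s ⊆ s') : bigGen G s ≤ bigGen G s' :=
  (bigGen_isCoprodExtClosed G s').bigGen_le fun _ hi => bigGen_shift_mem G (h hi)

lemma bigGen_Iic_shift (G : C) (n a n' : ℤ) (h : a + n' = n) (X : C)
    (hX : bigGen G (Set.Iic n) X) : bigGen G (Set.Iic n') (X⟦a⟧) := by
  refine ((bigGen_isCoprodExtClosed G (Set.Iic n')).shift a).bigGen_le (fun i hi => ?_) X hX
  rw [Set.mem_Iic] at hi
  exact (bigGen G (Set.Iic n')).prop_of_iso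
    ((shiftFunctorAdd' C (-i) a (-(i - a)) (by lia)).app G)
    (bigGen_shift_mem G (by rw [Set.mem_Iic]; lia))

lemma bigGen_Iic_shift_self (G : C) {n m : ℤ} (h : -m ≤ n) : bigGen G (Set.Iic n) (G⟦m⟧) := by
  simpa using bigGen_shift_mem G (s := Set.Iic n) (i := -m) h

lemma bigGen_rightOrthogonal_iff (G : C) (s : Set ℤ) (H : C) :
    (bigGen G s).rightOrthogonal H ↔ ∀ i ∈ s, ∀ f : G⟦-i⟧ ⟶ H, f = 0 := by
  refine ⟨fun h i hi f => h f (bigGen_shift_mem G hi), fun h X f hX => ?_⟩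
  refine (IsCoprodExtClosed.leftOrthogonal (fun Y => Y = H)).bigGen_le ?_ X hX f rfl
  rintro i hi _ g rfl
  exact h i hi g

/-- `F'` is the cone of the sum of all maps to be killed. The bound `-1` is the lowest possible: the
cone adds the shifts `G⟦n + 1⟧`, which must stay in the aisle. -/
lemma exists_kill_step (G : C) {F X : C} (f : F ⟶ X) :
    ∃ (F' : C) (φ : F ⟶ F') (f' : F' ⟶ X), φ ≫ f' = f ∧
      (∀ n : ℤ, -1 ≤ n → ∀ g : G⟦n⟧ ⟶ F, g ≫ f = 0 → g ≫ φ = 0) ∧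
      (bigGen G (Set.Iic 0) F → bigGen G (Set.Iic 0) F') := by
  let J := { p : Σ n : ℤ, (G⟦n⟧ ⟶ F) // -1 ≤ p.1 ∧ p.2 ≫ f = 0 }
  let Y : J → C := fun j => G⟦j.1.1⟧
  obtain ⟨F', φ, d, hT⟩ := distinguished_cocone_triangle (Sigma.desc fun j : J => j.1.2 : ∐ Y ⟶ F)
  obtain ⟨f', hf'⟩ := exists_desc₂ hT f (Sigma.hom_ext _ _ fun j => by
    rw [Sigma.ι_desc_assoc, j.2.2, comp_zero])
  refine ⟨F', φ, f', hf'.symm, fun n hn g hg => ?_, fun hF => ?_⟩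
  · have := Sigma.ι Y ⟨⟨n, g⟩, hn, hg⟩ ≫= distTriang_comp₁₂ hT
    rwa [Sigma.ι_desc_assoc, comp_zero] at this
  · refine (bigGen_isCoprodExtClosed G _).extension _ (rot_of_distTriang _ hT) hF ?_
    refine bigGen_Iic_shift G 1 1 0 (by lia) _ ?_
    refine (bigGen_isCoprodExtClosed G _).coproduct Y (fun j => ?_) _ (coproductIsCoproduct Y)
    exact bigGen_Iic_shift_self G (by have := j.2.1; lia)

/-- A small object argument. The initial stage makes `E → X` surjective on maps from `G⟦n⟧` for `n ≥
0`; the telescope of kill steps makes it injective for `n ≥ -1`. The exact sequence of Hom groups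
then leaves no nonzero map from `G⟦n⟧`, `n ≥ 0`, to the cone. -/
lemma exists_bigGen_triangle {G : C} (hG : IsCompactObj G) (X : C) :
    ∃ (E H : C) (f : E ⟶ X) (g : X ⟶ H) (h : H ⟶ E⟦(1 : ℤ)⟧), Triangle.mk f g h ∈ distTriang C ∧
      bigGen G (Set.Iic 0) E ∧ (bigGen G (Set.Iic 0)).rightOrthogonal H := by
  let J := { p : Σ n : ℤ, (G⟦n⟧ ⟶ X) // 0 ≤ p.1 }
  let Y : J → C := fun j => G⟦j.1.1⟧
  choose! F' φ' f' hφ hkill hmem using fun (o : Over X) => exists_kill_step G o.hom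
  let o : ℕ → Over X := fun n => Nat.rec (Over.mk (Sigma.desc fun j : J => j.1.2 : ∐ Y ⟶ X))
    (fun _ o => Over.mk (f' o)) n
  let φ : ∀ n, (o n).left ⟶ (o (n + 1)).left := fun n => φ' (o n)
  have ho : ∀ n, bigGen G (Set.Iic 0) (o n).left := by
    intro n
    induction n with
    | zero =>
      refine (bigGen_isCoprodExtClosed G _).coproduct Y (fun j => ?_) _ (coproductIsCoproduct Y)
      exact bigGen_Iic_shift_self G (by have := j.2; lia)
    | succ n ih => exact hmem _ ih
  obtain ⟨E, c, hE⟩ := exists_isTelescope φ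
  obtain ⟨e, he⟩ := hE.exists_desc (fun n => (o n).hom) fun n => hφ (o n)
  obtain ⟨H, g, h, hT⟩ := distinguished_cocone_triangle e
  refine ⟨E, H, e, g, h, hT, ?_, ?_⟩
  · obtain ⟨p, d, hT', -⟩ := hE
    have hS : bigGen G (Set.Iic 0) (∐ fun k : ULift.{v} ℕ => (o k.down).left) :=
      (bigGen_isCoprodExtClosed G _).coproduct (fun k : ULift.{v} ℕ => (o k.down).left)
        (fun k => ho k.down) _ (coproductIsCoproduct _)
    exact (bigGen_isCoprodExtClosed G _).extension _ (rot_of_distTriang _ hT') hS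
      (bigGen_mono G (Set.Iic_subset_Iic.2 (by lia)) _
        (bigGen_Iic_shift G 0 1 (-1) (by lia) _ hS))
  · have hinj : ∀ n : ℤ, -1 ≤ n → ∀ a : G⟦n⟧ ⟶ E, a ≫ e = 0 → a = 0 := by
      intro n hn a ha
      obtain ⟨m, b, rfl⟩ := hE.exists_factor ((compactObjects C).le_shift n G hG) a
      rw [Category.assoc, he] at ha
      rw [← hE.w, ← Category.assoc, hkill _ n hn b ha, zero_comp]
    rw [bigGen_rightOrthogonal_iff]
    intro i hi a
    rw [Set.mem_Iic] at hi
    -- Maps from `G⟦-i⟧` to `E⟦1⟧` are maps from `G⟦-i - 1⟧` to `E`; for `i = 0` this uses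
    -- injectivity in the extra degree `-1`.
    let e' : G⟦-i - 1⟧⟦(1 : ℤ)⟧ ≅ G⟦-i⟧ := ((shiftFunctorAdd' C (-i - 1) 1 (-i) (by lia)).app G).symm
    obtain ⟨b, hb⟩ := (shiftFunctor C (1 : ℤ)).map_surjective (e'.hom ≫ a ≫ h)
    have hb0 : b = 0 := by
      refine hinj _ (by lia) b ((shiftFunctor C (1 : ℤ)).map_injective ?_)
      rw [Functor.map_comp, hb, Functor.map_zero, Category.assoc, Category.assoc,
        distTriang_comp₃₁ hT, comp_zero, comp_zero]
    rw [hb0, Functor.map_zero] at hb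
    obtain ⟨x, rfl⟩ := exists_lift₃ hT a (by rw [← cancel_epi e'.hom, ← hb, comp_zero])
    have hx : x = (Sigma.ι Y ⟨⟨-i, x⟩, by lia⟩ ≫ c 0) ≫ e := by
      rw [Category.assoc, he]
      exact (Sigma.ι_desc (fun j : J => j.1.2) ⟨⟨-i, x⟩, by lia⟩).symm
    rw [hx, Category.assoc, distTriang_comp₁₂ hT, comp_zero]

/-- The t-structure generated by a compact object `G`, with aisle `genAisle G`. -/
noncomputable def genTStructure {G : C} (hG : IsCompactObj G) : TStructure C where
  le n := bigGen G (Set.Iic n)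
  ge n := (bigGen G (Set.Iic (n - 1))).rightOrthogonal
  le_shift n a n' h X hX := bigGen_Iic_shift G n a n' h X hX
  ge_shift n a n' h X hX := by
    intro Y f hY
    let e : Y ≅ Y⟦-a⟧⟦a⟧ := (shiftNegShift Y a).symm
    obtain ⟨b, hb⟩ := (shiftFunctor C a).map_surjective (e.inv ≫ f)
    rw [hX b (bigGen_Iic_shift G (n' - 1) (-a) (n - 1) (by lia) Y hY), Functor.map_zero] at hb
    rw [← cancel_epi e.inv, ← hb, comp_zero]
  zero' X Y f hX hY := hY f (by simpa using hX)
  le_zero_le := bigGen_mono G (Set.Iic_subset_Iic.2 (by lia))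
  ge_one_le X hX Y f hY := hX f (bigGen_mono G (Set.Iic_subset_Iic.2 (by lia)) _ hY)
  exists_triangle_zero_one X := by
    obtain ⟨E, H, f, g, h, hT, hE, hH⟩ := exists_bigGen_triangle hG X
    exact ⟨E, H, hE, by simpa using hH, f, g, h, hT⟩

/-- The objects in degrees `≤ n` form the left orthogonal of the objects in degrees `≥ n + 1`. -/
lemma le_eq_leftOrthogonal (t : TStructure C) (n : ℤ) :
    t.le n = (t.ge (n + 1)).leftOrthogonal := by
  ext X
  rw [t.le_iff_isLE, t.isLE_iff_orthogonal n (n + 1) rfl]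
  exact ⟨fun h Y f hY => h Y f ⟨hY⟩, fun h Y f hY => h f hY.ge⟩

lemma ge_eq_rightOrthogonal (t : TStructure C) (n : ℤ) :
    t.ge n = (t.le (n - 1)).rightOrthogonal := by
  ext X
  rw [t.ge_iff_isGE, t.isGE_iff_orthogonal (n - 1) n (by lia)]
  exact ⟨fun h Y f hY => h Y f ⟨hY⟩, fun h Y f hY => h f hY.le⟩

lemma le_isCoprodExtClosed (t : TStructure C) (n : ℤ) : IsCoprodExtClosed (t.le n) := by
  rw [le_eq_leftOrthogonal]
  exact .leftOrthogonal _

instance (t : TStructure C) (n : ℤ) : (t.le n).IsStableUnderRetracts := by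
  rw [le_eq_leftOrthogonal]
  infer_instance

lemma minus_iff (t : TStructure C) (X : C) : t.minus X ↔ ∃ n, t.le n X :=
  ⟨fun ⟨n, h⟩ => ⟨n, h.le⟩, fun ⟨n, h⟩ => ⟨n, ⟨h⟩⟩⟩

lemma plus_iff (t : TStructure C) (X : C) : t.plus X ↔ ∃ n, t.ge n X :=
  ⟨fun ⟨n, h⟩ => ⟨n, h.ge⟩, fun ⟨n, h⟩ => ⟨n, ⟨h⟩⟩⟩

lemma genTStructure_isPreferred {G : C} (hG : IsCompactGenerator G) :
    IsPreferred (genTStructure hG.1) := by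
  refine ⟨G, hG, 1, by lia, ?_, ?_⟩
  · change ((genTStructure hG.1).le 0).shift (-1 : ℤ) ≤ (genTStructure hG.1).le 0
    rw [TStructure.shift_le _ (-1) 0 (-1) (by lia)]
    exact TStructure.le_monotone _ (by lia)
  · change (genTStructure hG.1).le 0 ≤ ((genTStructure hG.1).le 0).shift (1 : ℤ)
    rw [TStructure.shift_le _ 1 0 1 (by lia)]
    exact TStructure.le_monotone _ (by lia)

end GeneratedTStructure

/-! ### Compact objects are built from a compact generator -/

section CompactGeneration

variable {C : Type u} [Category.{v} C] [Preadditive C] [HasZeroObject C] [HasShift C ℤ]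
  [∀ n : ℤ, (shiftFunctor C n).Additive] [Pretriangulated C] [IsTriangulated C]
  [HasCoproducts.{v} C]

/-- A compact object is bounded above for the t-structure generated by a compact generator. -/
lemma IsCompactObj.exists_le {G : C} (hG : IsCompactGenerator G) {K : C} (hK : IsCompactObj K) :
    ∃ n, (genTStructure hG.1).le n K := by
  set t := genTStructure hG.1 with ht
  let φ : ∀ n : ℕ, (t.truncGE (n : ℤ)).obj K ⟶ (t.truncGE ((n + 1 : ℕ) : ℤ)).obj K :=
    fun n => (t.natTransTruncGEOfLE n ((n + 1 : ℕ) : ℤ) (by lia)).app K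
  -- The homotopy colimit of the truncations `τ^{≥ n} K` is zero, since each shift of `G` is bounded
  -- above. By compactness `K → τ^{≥ m} K` vanishes for some `m`, making `K` a summand of `τ^{< m}
  -- K`.
  obtain ⟨H, c, hH⟩ := exists_isTelescope φ
  have hzero : ∀ (j : ℤ) (d k : ℕ) (a : G⟦j⟧ ⟶ (t.truncGE (k : ℤ)).obj K), -j < k + d →
      a ≫ c k = 0 := by
    intro j d
    induction d with
    | zero =>
      intro k a hk
      have : t.IsLE (G⟦j⟧) (-j) := ⟨bigGen_Iic_shift_self G le_rfl⟩
      rw [t.zero a (-j) k (by lia), zero_comp]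
    | succ d ih =>
      intro k a hk
      rw [← hH.w, ← Category.assoc]
      exact ih _ _ (by push_cast at hk ⊢; lia)
  have hH0 : IsZero H := hG.2 H fun j f => by
    obtain ⟨k, a, rfl⟩ := hH.exists_factor ((compactObjects C).le_shift j G hG.1) f
    exact hzero j (-j + 1 - k).toNat k a (by lia)
  obtain ⟨m, hm⟩ := hH.exists_eq_zero hK (fun n => (t.truncGEπ (n : ℤ)).app K)
    (fun n => t.π_natTransTruncGEOfLE_app _ _ _ K) (hH0.eq_of_tgt _ _)
  obtain ⟨s, hs⟩ := Triangle.coyoneda_exact₂ _ (t.triangleLTGE_distinguished m K) (𝟙 K)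
    ((Category.id_comp _).trans hm)
  exact ⟨(m : ℤ) - 1, (t.le _).prop_of_retract ⟨s, (t.truncLTι m).app K, hs.symm⟩
    (t.isLE_truncLT_obj K m (m - 1)).le⟩

/-- The morphism `f` factors through an object of `P`. -/
def FactorsThrough (P : ObjectProperty C) {X Y : C} (f : X ⟶ Y) : Prop :=
  ∃ (Z : C) (a : X ⟶ Z) (b : Z ⟶ Y), P Z ∧ f = a ≫ b

namespace FactorsThrough

variable {P : ObjectProperty C}

lemma biprod_mem [P.IsTriangulated] [P.IsClosedUnderIsomorphisms] {X Y : C} (hX : P X)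
    (hY : P Y) : P (X ⊞ Y) :=
  P.ext_of_isTriangulatedClosed₂ _ (binaryBiproductTriangle_distinguished X Y) hX hY

lemma add [P.IsTriangulated] [P.IsClosedUnderIsomorphisms] {X Y : C} {f g : X ⟶ Y}
    (hf : FactorsThrough P f) (hg : FactorsThrough P g) : FactorsThrough P (f + g) := by
  obtain ⟨Z, a, b, hZ, rfl⟩ := hf
  obtain ⟨Z', a', b', hZ', rfl⟩ := hg
  exact ⟨Z ⊞ Z', biprod.lift a a', biprod.desc b b', biprod_mem hZ hZ', by simp⟩

lemma zero [P.IsTriangulated] (X Y : C) : FactorsThrough P (0 : X ⟶ Y) := by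
  obtain ⟨Z, -, hZ⟩ := P.exists_prop_of_containsZero
  exact ⟨Z, 0, 0, hZ, by simp⟩

lemma sum [P.IsTriangulated] [P.IsClosedUnderIsomorphisms] {X Y : C} {J : Type*} (s : Finset J)
    (f : J → (X ⟶ Y)) (hf : ∀ j ∈ s, FactorsThrough P (f j)) :
    FactorsThrough P (∑ j ∈ s, f j) :=
  Finset.sum_induction f (FactorsThrough P) (fun _ _ => add) (zero X Y) hf

lemma comp {X Y W : C} {f : X ⟶ Y} (hf : FactorsThrough P f) (g : Y ⟶ W) :
    FactorsThrough P (f ≫ g) := by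
  obtain ⟨Z, a, b, hZ, rfl⟩ := hf
  exact ⟨Z, a, b ≫ g, hZ, Category.assoc _ _ _⟩

end FactorsThrough

/-- A morphism from a compact object to an object built from objects of `P` by coproducts and
extensions factors through an object of any triangulated subcategory of compact objects
containing `P`. -/
lemma factorsThrough_of_coprod {P S : ObjectProperty C} [S.IsTriangulated]
    [S.IsClosedUnderIsomorphisms] (hS : S ≤ compactObjects C) (hPS : P ≤ S) {Y : C}
    (hY : Coprod P Y) : ∀ ⦃K : C⦄, IsCompactObj K → ∀ f : K ⟶ Y, FactorsThrough S f := by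
  induction hY with
  | of Y hY => exact fun K _ f => ⟨Y, f, 𝟙 Y, hPS Y hY, (Category.comp_id f).symm⟩
  | coproduct Y _ c hc ih =>
    intro K hK f
    obtain ⟨s, a, rfl⟩ := hK.exists_sum c hc f
    exact FactorsThrough.sum s _ fun j _ => (ih j hK (a j)).comp _
  | extension T hT _ _ h₁ h₃ =>
    intro K hK f
    -- Factor the map to the third vertex through `W`, then the induced map from the fibre `K'` of
    -- `b` to the first vertex through `Z₁`; the extension `Z` of `W` by `Z₁` maps to the middle
    -- vertex.
    obtain ⟨W, b, c, hW, hbc⟩ := h₃ hK (f ≫ T.mor₂)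
    obtain ⟨K', k, w, hK'⟩ := distinguished_cocone_triangle₁ b
    have hK'c : IsCompactObj K' :=
      (compactObjects C).ext_of_isTriangulatedClosed₁ _ hK' hK (hS _ hW)
    obtain ⟨g, hg₁, hg₂⟩ := exists_hom₁ hK' hT f c hbc.symm
    obtain ⟨Z₁, g₁, g₂, hZ₁, rfl⟩ := h₁ hK'c g
    obtain ⟨Z, p, q, hZ⟩ := distinguished_cocone_triangle₂ (w ≫ g₁⟦(1 : ℤ)⟧')
    obtain ⟨h, hh₁, hh₂⟩ := exists_hom₂ hK' hZ g₁ (𝟙 W) (Category.id_comp _).symm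
    obtain ⟨e, he₁, he₂⟩ := exists_hom₂ hZ hT g₂ c (by
      rw [← hg₂, Functor.map_comp, Category.assoc])
    rw [Category.comp_id] at hh₂
    -- Fill-ins are not unique, so `h ≫ e` need not equal `f`; the error vanishes on `K'` and so
    -- factors through `W`.
    obtain ⟨s, hs⟩ := exists_desc₂ hK' (f - h ≫ e) (by
      rw [Preadditive.comp_sub, hg₁, reassoc_of% hh₁, he₁, Category.assoc, sub_self])
    have hfs : f = h ≫ e + b ≫ s := by rw [← hs, add_sub_cancel]
    rw [hfs]
    have hZS : S Z := S.ext_of_isTriangulatedClosed₂ _ hZ hZ₁ hW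
    exact .add ⟨Z, h, e, hZS, rfl⟩ ⟨W, b, s, hW, rfl⟩

/-- A thick subcategory containing a compact generator contains all compact objects. -/
lemma compactObjects_le {G : C} (hG : IsCompactGenerator G) (P : ObjectProperty C)
    [P.IsTriangulated] [P.IsStableUnderRetracts] (hP : P G) : compactObjects C ≤ P := by
  intro K hK
  obtain ⟨n, Y, hY, ⟨r⟩⟩ := hK.exists_le hG
  -- The inclusion of `K` as a summand of `Y` factors through some `Z` in `P`, so `K` is a summand
  -- of `Z`.
  obtain ⟨Z, a, b, hZ, hab⟩ := factorsThrough_of_coprod (S := P ⊓ compactObjects C)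
    inf_le_right (by
      rintro X ⟨i, -, ⟨e⟩⟩
      exact ObjectProperty.prop_of_iso _ e.symm (ObjectProperty.le_shift _ (-i) G ⟨hP, hG.1⟩))
    hY hK r.i
  exact P.prop_of_retract ⟨a, b ≫ r.r, by rw [← Category.assoc, ← hab, r.retract]⟩ hZ.1

end CompactGeneration

/-! ### Right t-exactness up to a shift, and independence of the t-structure -/

section Comparison

variable {C : Type u} [Category.{v} C] [Preadditive C] [HasZeroObject C] [HasShift C ℤ]
  [∀ n : ℤ, (shiftFunctor C n).Additive] [Pretriangulated C] [IsTriangulated C]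
  [HasCoproducts.{v} C]
  {C' : Type u₁} [Category.{v} C'] [Preadditive C'] [HasZeroObject C'] [HasShift C' ℤ]
  [∀ n : ℤ, (shiftFunctor C' n).Additive] [Pretriangulated C'] [IsTriangulated C']
  [HasCoproducts.{v} C']

/-- `F` is right t-exact up to a shift. -/
def IsRightBounded (F : C ⥤ C') (t : TStructure C) (t' : TStructure C') : Prop :=
  ∃ a : ℤ, ∀ (n : ℤ) (X : C), t.le n X → t'.le (n + a) (F.obj X)

lemma IsRightBounded.minus {F : C ⥤ C'} {t : TStructure C} {t' : TStructure C'}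
    (h : IsRightBounded F t t') {X : C} (hX : t.minus X) : t'.minus (F.obj X) := by
  obtain ⟨a, ha⟩ := h
  obtain ⟨n, hn⟩ := (minus_iff _ _).1 hX
  exact (minus_iff _ _).2 ⟨_, ha n X hn⟩

/-- The right adjoint of a functor which is right t-exact up to a shift preserves objects
bounded below. -/
lemma IsRightBounded.plus_of_adjunction {F : C ⥤ C'} {R : C' ⥤ C} (adj : F ⊣ R)
    [F.PreservesZeroMorphisms] {t : TStructure C} {t' : TStructure C'}
    (h : IsRightBounded F t t') {X : C'} (hX : t'.plus X) : t.plus (R.obj X) := by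
  obtain ⟨a, ha⟩ := h
  obtain ⟨n, hn⟩ := (plus_iff _ _).1 hX
  refine (plus_iff _ _).2 ⟨n - a, ?_⟩
  rw [ge_eq_rightOrthogonal] at hn ⊢
  intro Y f hY
  have h0 := hn ((adj.homEquiv _ _).symm f) (by
    have := ha _ _ hY
    rwa [show n - a - 1 + a = n - 1 by lia] at this)
  exact (adj.homEquiv _ _).symm.injective (h0.trans (by simp [adj.homEquiv_counit]))

/-- A triangulated functor preserving coproducts is right t-exact up to a shift for the t-structure
generated by `G` as soon as it sends `G` to an object bounded above. -/
lemma isRightBounded_of_minus (F : C ⥤ C') [F.CommShift ℤ] [F.IsTriangulated]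
    [∀ J : Type v, PreservesColimitsOfShape (Discrete J) F] {G : C} (hG : IsCompactObj G)
    {t' : TStructure C'} (h : t'.minus (F.obj G)) : IsRightBounded F (genTStructure hG) t' := by
  obtain ⟨a, ha⟩ := (minus_iff _ _).1 h
  refine ⟨a, fun n X hX => ?_⟩
  refine ((le_isCoprodExtClosed t' (n + a)).inverseImage F).bigGen_le (fun i hi => ?_) X hX
  rw [Set.mem_Iic] at hi
  exact (t'.le (n + a)).prop_of_iso ((F.commShiftIso (-i)).app G).symm
    (t'.le_monotone (by lia) _ (t'.le_shift a (-i) (a + i) (by lia) _ ha))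

/-- Each compact generator is bounded above for the t-structure generated by the other, so the
preferred class does not depend on the generator. -/
lemma isRightBounded_id_genTStructure {G G' : C} (hG : IsCompactGenerator G)
    (hG' : IsCompactGenerator G') :
    IsRightBounded (𝟭 C) (genTStructure hG.1) (genTStructure hG'.1) :=
  isRightBounded_of_minus (𝟭 C) hG.1 ((minus_iff _ _).2 (hG.1.exists_le hG'))

lemma IsRightBounded.trans {t t' t'' : TStructure C} (h : IsRightBounded (𝟭 C) t t')
    (h' : IsRightBounded (𝟭 C) t' t'') : IsRightBounded (𝟭 C) t t'' := by
  obtain ⟨a, ha⟩ := h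
  obtain ⟨b, hb⟩ := h'
  refine ⟨a + b, fun n X hX => ?_⟩
  rw [← add_assoc]
  exact hb _ _ (ha _ _ hX)

lemma isRightBounded_id_of_le {t t' : TStructure C} {a : ℤ} (h : t.le 0 ≤ t'.le a) :
    IsRightBounded (𝟭 C) t t' := by
  refine ⟨a, fun n X hX => ?_⟩
  have : t'.IsLE (X⟦n⟧) a := ⟨h _ (t.le_shift n n 0 (by lia) X hX)⟩
  exact (t'.isLE_of_shift X (n + a) n a).le

/-- A preferred t-structure is equivalent to the t-structure generated by any given compact
generator. -/
lemma IsPreferred.isRightBounded {t : TStructure C} (ht : IsPreferred t) {G : C}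
    (hG : IsCompactGenerator G) :
    IsRightBounded (𝟭 C) t (genTStructure hG.1) ∧ IsRightBounded (𝟭 C) (genTStructure hG.1) t := by
  obtain ⟨G', hG', A, -, h₁, h₂⟩ := ht
  change ((genTStructure hG'.1).le 0).shift (-A) ≤ t.le 0 at h₁
  change t.le 0 ≤ ((genTStructure hG'.1).le 0).shift A at h₂
  rw [TStructure.shift_le _ _ 0 _ (add_zero _)] at h₁ h₂
  have h₁' : (genTStructure hG'.1).le 0 ≤ t.le A := by
    intro X hX
    have : t.IsLE (X⟦A⟧) 0 := ⟨h₁ _ ((genTStructure hG'.1).le_shift 0 A (-A) (by lia) X hX)⟩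
    exact (t.isLE_of_shift X A A 0).le
  exact ⟨IsRightBounded.trans (isRightBounded_id_of_le h₂) (isRightBounded_id_genTStructure hG' hG),
    IsRightBounded.trans (isRightBounded_id_genTStructure hG hG') (isRightBounded_id_of_le h₁')⟩

lemma minusC_of_isRightBounded {t t' : TStructure C} (h : IsRightBounded (𝟭 C) t t') {X : C}
    (hX : minusC t X) : minusC t' X := by
  obtain ⟨a, ha⟩ := h
  intro m hm
  obtain ⟨E, E', f, g, d, hT, hE, hE'⟩ := hX (max 1 (m + a)) (by lia)
  exact ⟨E, E', f, g, d, hT, hE, t'.le_monotone (by lia) _ (ha _ _ hE')⟩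

lemma intrinsicMinusC_iff {G : C} (hG : IsCompactGenerator G) (X : C) :
    intrinsicMinusC C X ↔ minusC (genTStructure hG.1) X :=
  ⟨fun ⟨_, ht, hX⟩ => minusC_of_isRightBounded (ht.isRightBounded hG).1 hX,
    fun hX => ⟨_, genTStructure_isPreferred hG, hX⟩⟩

lemma IsRightBounded.plus_id {t t' : TStructure C} (h : IsRightBounded (𝟭 C) t t') {X : C}
    (hX : t'.plus X) : t.plus X :=
  h.plus_of_adjunction Adjunction.id hX

lemma intrinsicPlus_iff {G : C} (hG : IsCompactGenerator G) (X : C) :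
    intrinsicPlus C X ↔ (genTStructure hG.1).plus X :=
  ⟨fun ⟨_, ht, hX⟩ => (ht.isRightBounded hG).2.plus_id hX,
    fun hX => ⟨_, genTStructure_isPreferred hG, hX⟩⟩

lemma intrinsicBoundedC_iff {G : C} (hG : IsCompactGenerator G) (X : C) :
    intrinsicBoundedC C X ↔ boundedC (genTStructure hG.1) X :=
  ⟨fun ⟨_, ht, hX, hX', hX''⟩ => ⟨minusC_of_isRightBounded (ht.isRightBounded hG).1 hX,
    (ht.isRightBounded hG).2.plus_id hX', (ht.isRightBounded hG).1.minus hX''⟩,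
    fun hX => ⟨_, genTStructure_isPreferred hG, hX⟩⟩

end Comparison

/-! ### Thickness of `minusC` -/

section Thick

variable {C : Type u} [Category.{v} C] [Preadditive C] [HasZeroObject C] [HasShift C ℤ]
  [∀ n : ℤ, (shiftFunctor C n).Additive] [Pretriangulated C] [IsTriangulated C]
  [HasCoproducts.{v} C]

/-- There are no nonzero morphisms from a compact object to objects in sufficiently negative
degrees. -/
def CompactVanishing (t : TStructure C) : Prop :=
  ∀ K : C, IsCompactObj K → ∃ N : ℤ, (t.le N).leftOrthogonal K

lemma leftOrthogonal_le_mono (t : TStructure C) {n m : ℤ} (h : m ≤ n) {K : C}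
    (hK : (t.le n).leftOrthogonal K) : (t.le m).leftOrthogonal K :=
  fun _ f hY => hK f (t.le_monotone h _ hY)

/-- The objects without nonzero morphisms to objects in sufficiently negative degrees. -/
def eventuallyOrthogonal (t : TStructure C) : ObjectProperty C :=
  fun K => ∃ N : ℤ, (t.le N).leftOrthogonal K

instance (t : TStructure C) : (eventuallyOrthogonal t).IsStableUnderRetracts where
  of_retract := by
    rintro X Y r ⟨N, hN⟩
    exact ⟨N, ObjectProperty.prop_of_retract _ r hN⟩

instance (t : TStructure C) : (eventuallyOrthogonal t).IsTriangulated where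
  exists_zero := ⟨_, isZero_zero C, 0, fun _ _ _ => (isZero_zero C).eq_of_src _ _⟩
  isStableUnderShiftBy n := ⟨by
    rintro K ⟨N, hN⟩
    refine ⟨N - n, fun Y f hY => ?_⟩
    obtain ⟨b, hb⟩ := (shiftFunctor C n).map_surjective (f ≫ (shiftNegShift Y n).inv)
    rw [hN b (t.le_shift (N - n) (-n) N (by lia) Y hY), Functor.map_zero] at hb
    rw [← cancel_mono (shiftNegShift Y n).inv, ← hb, zero_comp]⟩
  toIsTriangulatedClosed₂ := .mk' fun T hT => by
    rintro ⟨N, hN⟩ ⟨N', hN'⟩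
    exact ⟨min N N', ObjectProperty.ext_of_isTriangulatedClosed₂ _ T hT
      (leftOrthogonal_le_mono t (min_le_left _ _) hN)
      (leftOrthogonal_le_mono t (min_le_right _ _) hN')⟩

lemma isCoprodExtClosed_orthogonal {K : C} (hK : IsCompactObj K) :
    IsCoprodExtClosed (fun X => ∀ f : K ⟶ X, f = 0) where
  coproduct Y hY c hc f := by
    obtain ⟨s, a, rfl⟩ := hK.exists_sum c hc f
    exact Finset.sum_eq_zero fun j _ => by rw [hY j (a j), zero_comp]
  extension T hT h₁ h₃ f := by
    obtain ⟨g, rfl⟩ := Triangle.coyoneda_exact₂ _ hT f (h₃ _)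
    rw [h₁ g, zero_comp]

instance (K : C) : ObjectProperty.IsStableUnderRetracts
    (fun X => ∀ f : K ⟶ X, f = 0 : ObjectProperty C) where
  of_retract r hY f := by
    rw [← Category.comp_id f, ← r.retract, ← Category.assoc, hY (f ≫ r.i), zero_comp]

lemma compactVanishing_of_generator {G : C} (hG : IsCompactGenerator G)
    (h : ∃ N : ℤ, ∀ n : ℤ, N ≤ n → ∀ f : G⟦-n⟧ ⟶ G, f = 0) :
    CompactVanishing (genTStructure hG.1) := by
  refine compactObjects_le hG (eventuallyOrthogonal _) ?_
  obtain ⟨N, hN⟩ := h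
  -- Maps `G ⟶ G⟦-i⟧` correspond to maps `G⟦i⟧ ⟶ G`, which vanish once `-i ≥ N`.
  refine ⟨-N, fun X f hX => ?_⟩
  refine (isCoprodExtClosed_orthogonal hG.1).bigGen_le (fun i hi g => ?_) X hX f
  rw [Set.mem_Iic] at hi
  obtain ⟨b, hb⟩ := (shiftFunctor C (-i)).map_surjective ((shiftShiftNeg G i).hom ≫ g)
  have hb0 : b = 0 := by
    have := hN (-i) (by lia)
    rw [neg_neg] at this
    exact this b
  rw [hb0, Functor.map_zero] at hb
  rw [← cancel_epi (shiftShiftNeg G i).hom, ← hb, comp_zero]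

lemma extensionProduct_le_le (t : TStructure C) (n : ℤ) :
    ObjectProperty.extensionProduct (t.le n) (t.le n) ≤ t.le n := by
  rintro X ⟨_, _, _, _, _, hT, h₁, h₃⟩
  exact (le_isCoprodExtClosed t n).extension _ hT h₁ h₃

lemma extensionProduct_compact_le :
    ObjectProperty.extensionProduct (compactObjects C) (compactObjects C) ≤ compactObjects C := by
  rintro X ⟨_, _, _, _, _, hT, h₁, h₃⟩
  exact (compactObjects C).ext_of_isTriangulatedClosed₂ _ hT h₁ h₃

/-- If there are no nonzero morphisms from objects of `Q` to shifts of objects of `P`, then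
extensions of objects of `Q` by objects of `P` split. -/
lemma extensionProduct_comm_of_orthogonal {P Q : ObjectProperty C}
    (h : ∀ A B : C, P A → Q B → ∀ f : B ⟶ A⟦(1 : ℤ)⟧, f = 0) :
    ObjectProperty.extensionProduct P Q ≤ ObjectProperty.extensionProduct Q P := by
  rintro X ⟨A, B, f, g, d, hT, hA, hB⟩
  obtain ⟨e, -, -⟩ := exists_iso_binaryBiproduct_of_distTriang _ hT (h A B hA hB d)
  exact (ObjectProperty.extensionProduct Q P).prop_of_iso
    (e ≪≫ biprod.braiding A B).symm
    ⟨_, _, _, _, _, binaryBiproductTriangle_distinguished B A, hB, hA⟩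

lemma minusC_iff (t : TStructure C) (X : C) :
    minusC t X ↔ ∀ m : ℤ, ObjectProperty.extensionProduct (compactObjects C) (t.le m) X := by
  refine ⟨fun h m => ?_, fun h m _ => h (-m)⟩
  obtain ⟨E, E', f, g, d, hT, hE, hE'⟩ := h (max 1 (-m)) (by lia)
  exact ⟨E, E', f, g, d, hT, hE, t.le_monotone (by lia) _ hE'⟩

/-- An object which is approximated arbitrarily well by objects of `minusC t` lies in
`minusC t`. -/
lemma minusC_of_extensionProduct {t : TStructure C} {X : C}
    (h : ∀ m : ℤ, ObjectProperty.extensionProduct (minusC t) (t.le m) X) : minusC t X := by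
  rw [minusC_iff]
  intro m
  obtain ⟨A, B, f, g, d, hT, hA, hB⟩ := h m
  have : ObjectProperty.extensionProduct
      (ObjectProperty.extensionProduct (compactObjects C) (t.le m)) (t.le m) X :=
    ⟨A, B, f, g, d, hT, (minusC_iff t A).1 hA m, hB⟩
  rw [ObjectProperty.extensionProduct_assoc] at this
  exact ObjectProperty.monotone_extensionProduct_right _ (extensionProduct_le_le t m) _ this

lemma minusC_of_isCompactObj (t : TStructure C) {X : C} (hX : IsCompactObj X) : minusC t X :=
  fun m _ => ⟨_, _, _, _, _, contractible_distinguished X, hX,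
    (t.isLE_of_isZero (isZero_zero C) (-m)).le⟩

instance (t : TStructure C) : ObjectProperty.IsClosedUnderIsomorphisms (minusC t) where
  of_iso e hX := (minusC_iff _ _).2 fun m =>
    ObjectProperty.prop_of_iso _ e ((minusC_iff _ _).1 hX m)

/-- Write the middle object as an iterated extension with pieces compact, `L`, `E`, `≤ m`. If the
first vertex is approximated deeply enough, depending on `E`, there are no maps `E → ΣL`; then `L`
and `E` can be swapped, and the compact pieces and the negative pieces merge. -/
lemma minusC_extension {t : TStructure C} (ht : CompactVanishing t) (T : Triangle C)
    (hT : T ∈ distTriang C) (h₁ : minusC t T.obj₁) (h₃ : minusC t T.obj₃) :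
    minusC t T.obj₂ := by
  rw [minusC_iff]
  intro m
  obtain ⟨E, Z, f, g, d, hT₃, hE, hZ⟩ := (minusC_iff t _).1 h₃ m
  obtain ⟨N, hN⟩ := ht E hE
  -- The bound `N + 1` is what puts `ΣL` in degrees `≤ N`.
  have hX := (minusC_iff t _).1 h₁ (min m (N + 1))
  let K := compactObjects C
  let L := t.le (min m (N + 1))
  let S : ObjectProperty C := fun Y => Y = E
  have hcomm : ObjectProperty.extensionProduct L S ≤ ObjectProperty.extensionProduct S L := by
    refine extensionProduct_comm_of_orthogonal ?_
    intro A B hA hB a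
    have hNB : (t.le N).leftOrthogonal B := by rwa [show B = E from hB]
    exact hNB a (t.le_shift (N + 1) 1 N (by lia) A (t.le_monotone (min_le_right _ _) _ hA))
  have hSK : S ≤ K := by
    intro B hB
    rwa [show B = E from hB]
  have h : ObjectProperty.extensionProduct (ObjectProperty.extensionProduct K L)
      (ObjectProperty.extensionProduct S (t.le m)) T.obj₂ :=
    ⟨_, _, _, _, _, hT, hX, ⟨E, Z, f, g, d, hT₃, rfl, hZ⟩⟩
  have hL : L ≤ t.le m := t.le_monotone (min_le_left _ _)
  rw [← ObjectProperty.extensionProduct_assoc, ObjectProperty.extensionProduct_assoc K] at h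
  replace h := ObjectProperty.monotone_extensionProduct_left _
    (ObjectProperty.monotone_extensionProduct_right K hcomm) _ h
  rw [← ObjectProperty.extensionProduct_assoc, ObjectProperty.extensionProduct_assoc] at h
  refine ObjectProperty.monotone_extensionProduct_left _ ?_ _
    (ObjectProperty.monotone_extensionProduct_right _ ?_ _ h)
  · exact (ObjectProperty.monotone_extensionProduct_right K hSK).trans extensionProduct_compact_le
  · exact (ObjectProperty.monotone_extensionProduct_left _ hL).trans (extensionProduct_le_le t m)

lemma minusC_isTriangulated {t : TStructure C} (ht : CompactVanishing t) :
    ObjectProperty.IsTriangulated (minusC t) where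
  exists_zero := ⟨_, isZero_zero C, minusC_of_isCompactObj t
    ((compactObjects C).prop_of_isZero (isZero_zero C))⟩
  isStableUnderShiftBy n := ⟨fun X hX => (minusC_iff _ _).2 fun m => by
    obtain ⟨E, Z, f, g, d, hT, hE, hZ⟩ := (minusC_iff _ _).1 hX (n + m)
    exact ⟨_, _, _, _, _, Triangle.shift_distinguished _ hT n,
      (compactObjects C).le_shift n E hE, t.le_shift _ n m rfl _ hZ⟩⟩
  toIsTriangulatedClosed₂ := .mk' fun T hT h₁ h₃ => minusC_extension ht T hT h₁ h₃

lemma minusC_le_minus {t : TStructure C} (ht : compactObjects C ≤ t.minus) :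
    minusC t ≤ t.minus := by
  intro X hX
  obtain ⟨E, Z, f, g, d, hT, hE, hZ⟩ := (minusC_iff t X).1 hX 0
  exact t.minus.ext_of_isTriangulatedClosed₂ _ hT (ht E hE) ((minus_iff _ _).2 ⟨0, hZ⟩)

/-- A retract `X` of an object of a triangulated subcategory `P` admits a morphism to `Σ² X` with
cone in `P`. -/
lemma exists_trW_of_retract {P : ObjectProperty C} [P.IsTriangulated]
    [P.IsClosedUnderIsomorphisms] {X Y : C} (r : Retract X Y) (hY : P Y) :
    ∃ e : X ⟶ X⟦(1 : ℤ)⟧⟦(1 : ℤ)⟧, P.trW e := by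
  obtain ⟨X', j, k, hT⟩ := distinguished_cocone_triangle r.i
  have : Mono r.i := mono_of_mono_fac r.retract
  obtain ⟨e, -, -⟩ := exists_iso_binaryBiproduct_of_distTriang _ hT
    (Triangle.mor₃_eq_zero_of_mono₁ _ hT this)
  have h₁ : P (X ⊞ X') := P.prop_of_iso e hY
  have h₂ : P (X' ⊞ X) := P.prop_of_iso (biprod.braiding X X') h₁
  -- The map `X ⊞ X' → X' → X' ⊞ X` has cone `W` in `P`. Its factors have cones `ΣX` and `X`, so the
  -- octahedron gives `ΣX → W → X → Σ²X`.
  obtain ⟨W, hW, a, b, hT'⟩ := P.distinguished_cocone_triangle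
    ((biprod.snd : X ⊞ X' ⟶ X') ≫ (biprod.inl : X' ⟶ X' ⊞ X)) h₁ h₂
  have o := someOctahedron rfl
    (rot_of_distTriang _ (binaryBiproductTriangle_distinguished X X'))
    (binaryBiproductTriangle_distinguished X' X) hT'
  exact ⟨_, _, _, _, rot_of_distTriang _ (rot_of_distTriang _ o.mem), P.le_shift (1 : ℤ) W hW⟩

/-- `minusC t` is closed under direct summands. -/
lemma minusC_isStableUnderRetracts {t : TStructure C} (ht : CompactVanishing t)
    (ht' : compactObjects C ≤ t.minus) : ObjectProperty.IsStableUnderRetracts (minusC t) where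
  of_retract {X Y} r hY := by
    have := minusC_isTriangulated ht
    have hXm : t.minus X := by
      obtain ⟨n, hn⟩ := (minus_iff _ _).1 (minusC_le_minus ht' Y hY)
      exact (minus_iff _ _).2 ⟨n, (t.le n).prop_of_retract r hn⟩
    obtain ⟨n, hn⟩ := (minus_iff _ _).1 hXm
    obtain ⟨e, he⟩ := exists_trW_of_retract r hY
    -- Iterating `X → Σ²X → Σ⁴X → ⋯` reaches arbitrarily negative degrees while the cone of the
    -- composite stays in `minusC t`; thus `X` is approximated by objects of `minusC t`.
    have key : ∀ k : ℕ, ∃ (Z : C) (d : X ⟶ Z) (e' : Z ⟶ Z⟦(1 : ℤ)⟧⟦(1 : ℤ)⟧),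
        ObjectProperty.trW (minusC t) d ∧ ObjectProperty.trW (minusC t) e' ∧ t.le (n - k) Z := by
      intro k
      induction k with
      | zero => exact ⟨X, 𝟙 X, e, MorphismProperty.id_mem _ X, he, by simpa using hn⟩
      | succ k ih =>
        obtain ⟨Z, d, e', hd, he', hZ⟩ := ih
        refine ⟨_, d ≫ e', _, MorphismProperty.comp_mem _ _ _ hd he', (he'.shift 1).shift 1, ?_⟩
        exact t.le_monotone (by push_cast; lia) _ (t.le_shift (n - k - 1) 1 (n - k - 2) (by lia) _
          (t.le_shift (n - k) 1 _ (by lia) _ hZ))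
    refine minusC_of_extensionProduct fun m => ?_
    obtain ⟨Z, d, -, ⟨V, a, b, hT, hV⟩, -, hZ⟩ := key (n - m).toNat
    exact ⟨_, _, _, _, _, inv_rot_of_distTriang _ hT,
      ObjectProperty.le_shift (minusC t) (-1 : ℤ) V hV, t.le_monotone (by lia) _ hZ⟩

end Thick

/-! ### Functors preserving `minusC`, and consequences of weak approximability -/

section Functors

variable {C : Type u} [Category.{v} C] [Preadditive C] [HasZeroObject C] [HasShift C ℤ]
  [∀ n : ℤ, (shiftFunctor C n).Additive] [Pretriangulated C] [IsTriangulated C]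
  [HasCoproducts.{v} C]
  {C' : Type u₁} [Category.{v} C'] [Preadditive C'] [HasZeroObject C'] [HasShift C' ℤ]
  [∀ n : ℤ, (shiftFunctor C' n).Additive] [Pretriangulated C'] [IsTriangulated C']
  [HasCoproducts.{v} C']

lemma compactObjects_le_minus {G : C} (hG : IsCompactGenerator G) :
    compactObjects C ≤ (genTStructure hG.1).minus :=
  fun _ hK => (minus_iff _ _).2 (IsCompactObj.exists_le hG hK)

/-- A triangulated functor preserving coproducts which sends a compact generator to an object of
`minusC` is right t-exact up to a shift and preserves `minusC`. -/
lemma minusC_map {F : C ⥤ C'} [F.CommShift ℤ] [F.IsTriangulated]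
    [∀ J : Type v, PreservesColimitsOfShape (Discrete J) F] {G : C} (hG : IsCompactGenerator G)
    {t' : TStructure C'} (ht' : CompactVanishing t') (hc : compactObjects C' ≤ t'.minus)
    (hFG : minusC t' (F.obj G)) :
    IsRightBounded F (genTStructure hG.1) t' ∧
      ∀ X : C, minusC (genTStructure hG.1) X → minusC t' (F.obj X) := by
  have hF := isRightBounded_of_minus F hG.1 (minusC_le_minus hc _ hFG)
  refine ⟨hF, fun X hX => minusC_of_extensionProduct fun m => ?_⟩
  obtain ⟨a, ha⟩ := hF
  obtain ⟨E, E', f, g, d, hT, hE, hE'⟩ := (minusC_iff _ X).1 hX (m - a)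
  have := minusC_isTriangulated ht'
  have := minusC_isStableUnderRetracts ht' hc
  -- The preimage of `minusC t'` under `F` is thick and contains `G`, hence contains every compact
  -- object.
  have hFE := compactObjects_le hG (ObjectProperty.inverseImage (minusC t') F) hFG E hE
  have hFE' := ha _ _ hE'
  rw [sub_add_cancel] at hFE'
  exact ⟨_, _, _, _, _, F.map_distinguished _ hT, hFE, hFE'⟩

/-- A left adjoint triangulated functor whose right adjoint preserves coproducts and is
conservative on objects sends compact generators to compact generators. -/
lemma IsCompactGenerator.map_leftAdjoint {F : C ⥤ C'} {R : C' ⥤ C} (adj : F ⊣ R) [F.CommShift ℤ]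
    [F.Additive] [∀ J : Type v, PreservesColimitsOfShape (Discrete J) R]
    (hR : ∀ X, IsZero (R.obj X) → IsZero X) {G : C} (hG : IsCompactGenerator G) :
    IsCompactGenerator (F.obj G) := by
  refine ⟨hG.1.map_leftAdjoint adj, fun X hX => hR X (hG.2 _ fun n f => ?_)⟩
  refine (adj.homEquiv _ _).symm.injective ?_
  rw [← cancel_epi ((F.commShiftIso n).inv.app G)]
  exact (hX n _).trans (hX n _).symm

lemma WeaklyApproximable.exists_generator (h : WeaklyApproximable C) :
    ∃ (G : C) (hG : IsCompactGenerator G), CompactVanishing (genTStructure hG.1) := by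
  obtain ⟨G, t, A, hG, -, hA, hA', -⟩ := h
  -- Shifting turns a map `G⟦-n⟧ ⟶ G` into one from `G⟦-A⟧` to `G⟦n - A⟧`. The target lies in
  -- degrees `≤ 2A - n`, so the map vanishes for `n ≥ 2A`.
  refine ⟨G, hG, compactVanishing_of_generator hG ⟨2 * A, fun n hn f => ?_⟩⟩
  let e : G⟦-n⟧ ≅ G⟦-A⟧⟦A - n⟧ := (shiftFunctorAdd' C (-A) (A - n) (-n) (by lia)).app G
  let e' : G ≅ G⟦n - A⟧⟦A - n⟧ :=
    (shiftFunctorCompIsoId C (n - A) (A - n) (by lia)).symm.app G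
  obtain ⟨b, hb⟩ := (shiftFunctor C (A - n)).map_surjective (e.inv ≫ f ≫ e'.hom)
  have : t.IsLE (G⟦A⟧) 0 := ⟨hA⟩
  have : t.IsLE G A := t.isLE_of_shift G A A 0
  have : t.IsLE (G⟦n - A⟧) (2 * A - n) := t.isLE_shift G A (n - A) _
  rw [hA' _ (t.isLE_of_le (G⟦n - A⟧) (2 * A - n) 0).le b, Functor.map_zero] at hb
  rw [← cancel_epi e.inv, ← cancel_mono e'.hom, Category.assoc, ← hb, comp_zero, zero_comp]

end Functors

/-! ### The compact generator of `DF` and its vanishing property -/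

namespace Recollement

variable {DF : Type u₁} {D : Type u} {DU : Type u₂}
  [Category.{v} DF] [Preadditive DF] [HasZeroObject DF] [HasShift DF ℤ]
  [∀ n : ℤ, (shiftFunctor DF n).Additive] [Pretriangulated DF] [IsTriangulated DF]
  [HasCoproducts.{v} DF]
  [Category.{v} D] [Preadditive D] [HasZeroObject D] [HasShift D ℤ]
  [∀ n : ℤ, (shiftFunctor D n).Additive] [Pretriangulated D] [IsTriangulated D]
  [HasCoproducts.{v} D]
  [Category.{v} DU] [Preadditive DU] [HasZeroObject DU] [HasShift DU ℤ]
  [∀ n : ℤ, (shiftFunctor DU n).Additive] [Pretriangulated DU] [IsTriangulated DU]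
  [HasCoproducts.{v} DU]

attribute [instance] commShift_iUpperStar commShift_iLowerStar commShift_iUpperShriek
  commShift_jLowerShriek commShift_jUpperStar commShift_jLowerStar isTriangulated_iUpperStar
  isTriangulated_iLowerStar isTriangulated_iUpperShriek isTriangulated_jLowerShriek
  isTriangulated_jUpperStar isTriangulated_jLowerStar full_iLowerStar faithful_iLowerStar

variable (R : Recollement DF D DU)

instance (J : Type v) : PreservesColimitsOfShape (Discrete J) R.iUpperStar :=
  have := R.adjIStar.leftAdjoint_preservesColimits
  inferInstance

instance (J : Type v) : PreservesColimitsOfShape (Discrete J) R.iLowerStar :=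
  have := R.adjIShriek.leftAdjoint_preservesColimits
  inferInstance

instance (J : Type v) : PreservesColimitsOfShape (Discrete J) R.jLowerShriek :=
  have := R.adjJShriek.leftAdjoint_preservesColimits
  inferInstance

instance (J : Type v) : PreservesColimitsOfShape (Discrete J) R.jUpperStar :=
  have := R.adjJStar.leftAdjoint_preservesColimits
  inferInstance

/-- `i^*` sends a compact generator to a compact generator. -/
lemma isCompactGenerator_iUpperStar {G : D} (hG : IsCompactGenerator G) :
    IsCompactGenerator (R.iUpperStar.obj G) :=
  hG.map_leftAdjoint R.adjIStar fun X hX => by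
    rw [IsZero.iff_id_eq_zero] at hX ⊢
    exact R.iLowerStar.map_injective (by rw [R.iLowerStar.map_id, hX, R.iLowerStar.map_zero])

/-- The generator `i^* G` has no nonzero morphisms from its sufficiently negative shifts if
`i_* i^* G` is bounded above. -/
lemma compactVanishing_iUpperStar {G : D} (hG : IsCompactGenerator G)
    (hD : CompactVanishing (genTStructure hG.1))
    (h : (genTStructure hG.1).minus (R.iLowerStar.obj (R.iUpperStar.obj G))) :
    CompactVanishing (genTStructure (R.isCompactGenerator_iUpperStar hG).1) := by
  refine compactVanishing_of_generator (R.isCompactGenerator_iUpperStar hG) ?_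
  obtain ⟨a, ha⟩ := (minus_iff _ _).1 h
  obtain ⟨N, hN⟩ := hD G hG.1
  -- By adjunction the maps become `G⟦-n⟧ ⟶ i_* i^* G`, that is, maps from `G` to an object in
  -- degrees `≤ a - n`; these vanish once `a - n ≤ N`.
  refine ⟨a - N, fun n hn f => ?_⟩
  rw [← cancel_epi ((R.iUpperStar.commShiftIso (-n)).hom.app G), comp_zero]
  refine (R.adjIStar.homEquiv _ _).injective ?_
  have hzero : ∀ g : G⟦-n⟧ ⟶ R.iLowerStar.obj (R.iUpperStar.obj G), g = 0 := by
    intro g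
    let e := (shiftShiftNeg (R.iLowerStar.obj (R.iUpperStar.obj G)) n).symm
    obtain ⟨b, hb⟩ := (shiftFunctor D (-n)).map_surjective (g ≫ e.hom)
    have hle := (genTStructure hG.1).le_shift a n (a - n) (by lia) _ ha
    rw [hN b ((genTStructure hG.1).le_monotone (by lia) _ hle), Functor.map_zero] at hb
    rw [← cancel_mono e.hom, ← hb, zero_comp]
  exact (hzero _).trans (hzero _).symm

end Recollement

end TriGluing

theorem proposition2
    {DF : Type u₁} {D : Type u} {DU : Type u₂}
    [Category.{v} DF] [Preadditive DF] [HasZeroObject DF] [HasShift DF ℤ]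
    [∀ n : ℤ, (shiftFunctor DF n).Additive] [Pretriangulated DF] [IsTriangulated DF]
    [HasCoproducts.{v} DF]
    [Category.{v} D] [Preadditive D] [HasZeroObject D] [HasShift D ℤ]
    [∀ n : ℤ, (shiftFunctor D n).Additive] [Pretriangulated D] [IsTriangulated D]
    [HasCoproducts.{v} D]
    [Category.{v} DU] [Preadditive DU] [HasZeroObject DU] [HasShift DU ℤ]
    [∀ n : ℤ, (shiftFunctor DU n).Additive] [Pretriangulated DU] [IsTriangulated DU]
    [HasCoproducts.{v} DU]
    (R : TriGluing.Recollement DF D DU)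
    (hDU : TriGluing.WeaklyApproximable DU)
    (G : D) (hG : TriGluing.IsCompactGenerator G)
    (hGG : ∃ N : ℤ, ∀ n : ℤ, N ≤ n → ∀ f : G⟦-n⟧ ⟶ G, f = 0)
    (hjG : TriGluing.intrinsicMinusC DU (R.jUpperStar.obj G)) :
    (∀ X : D, TriGluing.intrinsicMinusC D X ↔
      TriGluing.intrinsicMinusC DF (R.iUpperStar.obj X) ∧
      TriGluing.intrinsicMinusC DU (R.jUpperStar.obj X)) ∧
    (∀ X : D, TriGluing.intrinsicBoundedC D X ↔
      TriGluing.intrinsicMinusC DF (R.iUpperStar.obj X) ∧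
      TriGluing.intrinsicBoundedC DU (R.jUpperStar.obj X) ∧
      TriGluing.intrinsicPlus DF (R.iUpperShriek.obj X)) := by
  open TriGluing in
  obtain ⟨GU, hGU, hvU⟩ := hDU.exists_generator
  have hGF := R.isCompactGenerator_iUpperStar hG
  have hv := compactVanishing_of_generator hG hGG
  have hM := minusC_isTriangulated hv
  rw [intrinsicMinusC_iff hGU] at hjG
  have hcF := compactObjects_le_minus hGF
  have hc := compactObjects_le_minus hG
  have hcU := compactObjects_le_minus hGU
  obtain ⟨bj, mj⟩ := minusC_map hG hvU hcU hjG
  obtain ⟨bj', mj'⟩ := minusC_map (F := R.jLowerShriek) hGU hv hc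
    (minusC_of_isCompactObj _ (hGU.1.map_leftAdjoint R.adjJShriek))
  -- The hypothesis on `j^*G` is decisive here: `j_! j^* G` lies in `minusC`, and so does the cone
  -- of its map to `G`.
  have hiG : minusC (genTStructure hG.1) (R.iLowerStar.obj (R.iUpperStar.obj G)) :=
    ObjectProperty.ext_of_isTriangulatedClosed₃ _ _ (R.triangle_shriek_star G) (mj' _ hjG)
      (minusC_of_isCompactObj _ hG.1)
  have hvF := R.compactVanishing_iUpperStar hG hv (minusC_le_minus hc _ hiG)
  obtain ⟨bi, mi⟩ := minusC_map (F := R.iUpperStar) hG hvF hcF (minusC_of_isCompactObj _ hGF.1)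
  obtain ⟨bi', mi'⟩ := minusC_map (F := R.iLowerStar) hGF hv hc hiG
  have key : ∀ X : D, minusC (genTStructure hG.1) X ↔
      minusC (genTStructure hGF.1) (R.iUpperStar.obj X) ∧
      minusC (genTStructure hGU.1) (R.jUpperStar.obj X) := fun X =>
    ⟨fun hX => ⟨mi X hX, mj X hX⟩, fun ⟨hF, hU⟩ =>
      ObjectProperty.ext_of_isTriangulatedClosed₂ _ _ (R.triangle_shriek_star X)
        (mj' _ hU) (mi' _ hF)⟩
  simp only [intrinsicMinusC_iff hG, intrinsicMinusC_iff hGF, intrinsicMinusC_iff hGU,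
    intrinsicBoundedC_iff hG, intrinsicBoundedC_iff hGU, intrinsicPlus_iff hGF]
  refine ⟨key, fun X => ⟨fun hX => ?_, fun ⟨hF, hU, hF'⟩ => ?_⟩⟩
  · exact ⟨mi X hX.1, ⟨mj X hX.1, bj'.plus_of_adjunction R.adjJShriek hX.2.1, bj.minus hX.2.2⟩,
      bi'.plus_of_adjunction R.adjIShriek hX.2.1⟩
  · have hX := (key X).2 ⟨hF, hU.1⟩
    refine ⟨hX, ?_, minusC_le_minus hc X hX⟩
    -- Both outer terms are bounded below because `i_*` and `j_*` are right adjoint to functors that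
    -- are right t-exact up to a shift.
    exact ObjectProperty.ext_of_isTriangulatedClosed₂ _ _ (R.triangle_star_shriek X)
      (bi.plus_of_adjunction R.adjIStar hF') (bj.plus_of_adjunction R.adjJStar hU.2.1)
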